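/- Let $N\ge 1$. A point of the complete flag manifold $\mathcal F_{1,\dots,N}=\mathrm U(N)/\mathrm U(1)^N$ is represented by an orthonormal frame $u_1,\dots,u_N$ of $\mathbb C^N$, each $u_i$ being defined up to a phase; let $\mathbf u$ be the unitary matrix with rows $u_i$, and write $\bar u\circ v=\sum_k \overline{u^k}\,v^k$. A metric with nested structure is an invariant metric $$ds^2=\sum_{j<i}c_{ij}\,|\bar u_j\circ du_i|^2,\qquad c_{ij}=\sum_{B\ni i,j}c_B>0\quad (i\ne j),$$ where $B$ runs over a finite set of intervals ("brackets") of $\{1,\dots,N\}$, no two of which overlap partially (any two are disjoint or one contains the other), with real coefficients $c_B$. For a curve of frames put $\omega_{ij}=\dot{\bar u}_j\circ u_i$ and let $L_{ij}=c_{ij}\omega_{ij}$ for $i\neq j$, $L_{ii}=0$. Geodesics are the smooth curves of flags that are stationary for the action $\int\sum_{j<i}c_{ij}|\bar u_j\circ\dot u_i|^2dt$ on every compact time interval under smooth variations with fixed end points. Then: (1) On any open set of times, the flag of a smooth curve of frames is a geodesic if and only if $\dfrac{dL}{dt}=[L,\omega]$. (2) The metric is given by a bracket tree, in which each bracket contains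 either no inner brackets (only nodes, at least one) or exactly two adjacent brackets that together hold all its nodes, and each bracket carries one number $c$ that is the value of $c_{ij}$ for all pairs $i\ne j$ of nodes lying in this bracket and in no smaller one. (3) For any such tree and any skew-Hermitian $N\times N$ matrix $W$ with zero diagonal define $G(t)=G_W(t)$ by induction over the tree. For a bracket without inner brackets $G(t)=e^{-tW}$. For a bracket with coefficient $c=1/\xi$ and two inner brackets, write $W=\begin{pmatrix}W_1&\Omega\\-\Omega^\dagger&W_2\end{pmatrix}$, let $g_1,g_2$ be the matrices already constructed for the inner brackets and $W_1,W_2$, let $A,B$ be the matrices with zero diagonal and off-diagonal entries $c_{ij}(W_1)_{ij}$, $c_{ij}(W_2)_{ij}$ respectively, and put $$G(t)=\begin{pmatrix}g_1(t)&0\\0&g_2(t)\end{pmatrix}\begin{pmatrix}e^{\xi At}&0\\0&e^{\xi Bt}\end{pmatrix}\exp\left[-t\begin{pmatrix}\xi A&\Omega\\-\Omega^\dagger&\xi B\end{pmatrix}\right].$$ Then $\mathbf u(t)=G_W(t)\mathbf u_0$ is the general solution of the geodesic equations: (a) for all unitary $\mathbf u_0$ and all such $W$, $\mathbf u(t)=G_W(t)\mathbf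 u_0$, $t\in\mathbb R$, is a smooth curve of unitary frames with $\mathbf u(0)=\mathbf u_0$, $\omega(0)=W$ and $\bar u_i\circ\dot u_i=0$ for all $i$, and its flag is a geodesic; (b) conversely, if a smooth curve of frames on an open interval containing $0$ satisfies $\bar u_i\circ\dot u_i=0$ for all $i$ and its flag is a geodesic, then $\omega(0)$ is skew-Hermitian with zero diagonal and $\mathbf u(t)=G_{\omega(0)}(t)\mathbf u(0)$; (c) for every geodesic of flags on an open interval containing $0$ and every frame $\mathbf u_0$ of its flag at time $0$ there is exactly one such $W$ for which $G_W(t)\mathbf u_0$ is a frame of the geodesic at every time $t$ in the interval. -/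

import Mathlib

open scoped ContDiff Matrix

/-! A frame `u₁, …, u_N` of `ℂᴺ` is a unitary matrix whose `i`-th row is the vector `u_i`. -/

/-- Two unitary frames are equivalent if their vectors agree up to phase factors. -/
def flagSetoid (N : ℕ) : Setoid (Matrix.unitaryGroup (Fin N) ℂ) where
  r u v := ∃ d : Fin N → ℂ, (∀ i, ‖d i‖ = 1) ∧ ∀ i k, u.1 i k = d i * v.1 i k
  iseqv :=
    { refl := fun u => ⟨fun _ => 1, by simp, by simp⟩
      symm := by
        rintro u v ⟨d, hd, h⟩
        refine ⟨fun i => (d i)⁻¹, fun i => by simp [hd i], fun i k => ?_⟩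
        have hne : d i ≠ 0 := by
          intro h0
          have h1 := hd i
          simp [h0] at h1
        rw [h i k, inv_mul_cancel_left₀ hne]
      trans := by
        rintro u v w ⟨d, hd, h⟩ ⟨e, he, h'⟩
        exact ⟨fun i => d i * e i, fun i => by simp [hd i, he i],
          fun i k => by rw [h i k, h' i k, mul_assoc]⟩ }

/-- The complete flag manifold `U(N) / U(1)ᴺ`: orthonormal frames of `ℂᴺ` up to phases. -/
def CompleteFlag (N : ℕ) : Type := Quotient (flagSetoid N)

/-- The flag spanned by a frame. -/
def toFlag {N : ℕ} (u : Matrix.unitaryGroup (Fin N) ℂ) : CompleteFlag N :=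
  Quotient.mk (flagSetoid N) u

/-- The Hermitian product `ū ∘ v = ∑ k, conj (u k) * v k`. -/
def hprod {N : ℕ} (u v : Fin N → ℂ) : ℂ := ∑ k, star (u k) * v k

/-- Smoothness (all entries are `C^∞`) of a family of frames. -/
def SmoothFrameOn {E : Type*} [NormedAddCommGroup E] [NormedSpace ℝ E] {N : ℕ}
    (u : E → Matrix.unitaryGroup (Fin N) ℂ) (s : Set E) : Prop :=
  ∀ i k, ContDiffOn ℝ ∞ (fun x => (u x).1 i k) s

/-- The velocity of the `i`-th vector of a curve of frames. -/
noncomputable def velocity {N : ℕ} (u : ℝ → Matrix.unitaryGroup (Fin N) ℂ) (t : ℝ) (i : Fin N) :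
    Fin N → ℂ :=
  fun k => deriv (fun τ => (u τ).1 i k) t

/-- The action `∫ₐᵇ ∑_{j < i} c_{ij} |ū_j ∘ u̇_i|² dt` of a curve of frames, obtained from the
invariant metric `ds² = ∑_{j < i} c_{ij} |ū_j ∘ du_i|²` on the complete flag manifold. It does not
change when the vectors are multiplied by time-dependent phases. -/
noncomputable def flagAction {N : ℕ} (c : Fin N → Fin N → ℝ) (a b : ℝ)
    (u : ℝ → Matrix.unitaryGroup (Fin N) ℂ) : ℝ :=
  ∫ t in a..b, ∑ i, ∑ j ∈ Finset.Iio i, c i j * ‖hprod ((u t).1 j) (velocity u t i)‖ ^ 2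

/-- `γ` restricted to the open set `J` of times is a geodesic of the metric
`ds² = ∑_{j < i} c_{ij} |ū_j ∘ du_i|²`: it is smooth (it lifts to a smooth curve of frames), and on
every compact interval in `J` it is a stationary point of the action with respect to all smooth
variations of the curve of flags with fixed end points. -/
def IsGeodesicOn {N : ℕ} (c : Fin N → Fin N → ℝ) (γ : ℝ → CompleteFlag N) (J : Set ℝ) : Prop :=
  (∃ u : ℝ → Matrix.unitaryGroup (Fin N) ℂ, SmoothFrameOn u J ∧ ∀ t ∈ J, toFlag (u t) = γ t) ∧
  ∀ a b : ℝ, a < b → Set.Icc a b ⊆ J →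
    ∀ v : ℝ × ℝ → Matrix.unitaryGroup (Fin N) ℂ, SmoothFrameOn v (Set.univ ×ˢ J) →
      (∀ t ∈ J, toFlag (v (0, t)) = γ t) →
      (∀ s, toFlag (v (s, a)) = γ a) → (∀ s, toFlag (v (s, b)) = γ b) →
      HasDerivAt (fun s => flagAction c a b (fun t => v (s, t))) 0 0

/-- The matrix `ω_{ij} = (d ū_j / dt) ∘ u_i` of a curve of frames. -/
noncomputable def angularVelocity {N : ℕ} (u : ℝ → Matrix.unitaryGroup (Fin N) ℂ) (t : ℝ) :
    Matrix (Fin N) (Fin N) ℂ :=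
  Matrix.of fun i j => hprod (velocity u t j) ((u t).1 i)

/-- The matrix `L_{ij} = c_{ij} w_{ij}` for `i ≠ j`, with zero diagonal. -/
noncomputable def angularMomentum {N : ℕ} (c : Fin N → Fin N → ℝ) (w : Matrix (Fin N) (Fin N) ℂ) :
    Matrix (Fin N) (Fin N) ℂ :=
  Matrix.of fun i j => if i = j then 0 else (c i j : ℂ) * w i j

/-- The generalized Euler equation `dL/dt = [L, ω]` at the times in `J`. -/
def EulerOn {N : ℕ} (c : Fin N → Fin N → ℝ) (u : ℝ → Matrix.unitaryGroup (Fin N) ℂ)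
    (J : Set ℝ) : Prop :=
  ∀ t ∈ J, ∀ i j, HasDerivAt (fun τ => angularMomentum c (angularVelocity u τ) i j)
    (⁅angularMomentum c (angularVelocity u t), angularVelocity u t⁆ i j) t

/-- The gauge condition `ū_i ∘ u̇_i = 0`. -/
def HorizontalOn {N : ℕ} (u : ℝ → Matrix.unitaryGroup (Fin N) ℂ) (J : Set ℝ) : Prop :=
  ∀ t ∈ J, ∀ i, hprod ((u t).1 i) (velocity u t i) = 0

/-- A nested diagram on the nodes `1, …, N`, describing an invariant metric: a set of brackets
(non-empty intervals of nodes), no two of which overlap partially, with real coefficients, such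
that every pair of nodes gets a positive total coefficient. -/
structure NestedDiagram (N : ℕ) where
  brackets : Finset (Finset (Fin N))
  interval : ∀ B ∈ brackets, ∃ I K : Fin N, I ≤ K ∧ B = Finset.Icc I K
  nested : ∀ B ∈ brackets, ∀ B' ∈ brackets, B ⊆ B' ∨ B' ⊆ B ∨ Disjoint B B'
  coeff : Finset (Fin N) → ℝ
  pos : ∀ i j, i ≠ j → 0 < ∑ B ∈ brackets with i ∈ B ∧ j ∈ B, coeff B

/-- The coefficient of `|ū_i ∘ du_j|²` in the metric given by the diagram: the sum of the
coefficients of the brackets that contain both nodes. -/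
def NestedDiagram.metric {N : ℕ} (D : NestedDiagram N) (i j : Fin N) : ℝ :=
  ∑ B ∈ D.brackets with i ∈ B ∧ j ∈ B, D.coeff B

/-- Bracket trees with `N` nodes: a bracket contains either no brackets (only nodes, at least
one) or exactly two adjacent brackets that together hold all its nodes. The number `c` is the
coefficient in the metric of the pairs of nodes that lie in this bracket and in no smaller one. -/
inductive BracketTree : ℕ → Type
  | leaf (n : ℕ) (c : ℝ) : BracketTree (n + 1)
  | node {n k : ℕ} (c : ℝ) (T₁ : BracketTree n) (T₂ : BracketTree k) : BracketTree (n + k)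

/-- The block matrix with the given blocks, the first `n` indices before the last `k`. -/
def blocks {R : Type*} {n k : ℕ} (A : Matrix (Fin n) (Fin n) R) (B : Matrix (Fin n) (Fin k) R)
    (C : Matrix (Fin k) (Fin n) R) (D : Matrix (Fin k) (Fin k) R) :
    Matrix (Fin (n + k)) (Fin (n + k)) R :=
  Matrix.reindex finSumFinEquiv finSumFinEquiv (Matrix.fromBlocks A B C D)

/-- The coefficients of the metric given by a bracket tree (only those with `i ≠ j` matter). -/
def BracketTree.metric {N : ℕ} : BracketTree N → Fin N → Fin N → ℝ
  | .leaf _ c => fun _ _ => c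
  | .node c T₁ T₂ => blocks (Matrix.of T₁.metric) (Matrix.of fun _ _ => c)
      (Matrix.of fun _ _ => c) (Matrix.of T₂.metric)

/-- The tree and the diagram describe the same metric. -/
def BracketTree.Represents {N : ℕ} (T : BracketTree N) (D : NestedDiagram N) : Prop :=
  ∀ i j, i ≠ j → T.metric i j = D.metric i j

/-- The explicit solution operator `G(t)` of a bracket tree with initial angular velocity `W`.
For a bracket without inner brackets it is `exp(-tW)`. For a bracket with two inner brackets and
metric coefficient `c = 1/ξ` it is
`diag(g₁, g₂) * diag(exp(ξtA), exp(ξtB)) * exp(-t [[ξA, Ω], [-Ωᴴ, ξB]])`, where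
`W = [[W₁, Ω], [*, W₂]]`, `g₁` and `g₂` are the operators of the inner brackets for `W₁` and `W₂`,
and `A`, `B` are their initial angular momenta. -/
noncomputable def BracketTree.solution {N : ℕ} :
    BracketTree N → Matrix (Fin N) (Fin N) ℂ → ℝ → Matrix (Fin N) (Fin N) ℂ
  | .leaf _ _, W, t => NormedSpace.exp (-((t : ℂ) • W))
  | .node (n := n) (k := k) c T₁ T₂, W, t =>
      let W₁ : Matrix (Fin n) (Fin n) ℂ := W.submatrix (Fin.castAdd k) (Fin.castAdd k)
      let W₂ : Matrix (Fin k) (Fin k) ℂ := W.submatrix (Fin.natAdd n) (Fin.natAdd n)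
      let Ω : Matrix (Fin n) (Fin k) ℂ := W.submatrix (Fin.castAdd k) (Fin.natAdd n)
      let ξ : ℂ := ((c⁻¹ : ℝ) : ℂ)
      let A : Matrix (Fin n) (Fin n) ℂ := angularMomentum T₁.metric W₁
      let B : Matrix (Fin k) (Fin k) ℂ := angularMomentum T₂.metric W₂
      blocks (T₁.solution W₁ t) 0 0 (T₂.solution W₂ t) *
        blocks (NormedSpace.exp (((t : ℂ) * ξ) • A)) 0 0 (NormedSpace.exp (((t : ℂ) * ξ) • B)) *
        NormedSpace.exp (-((t : ℂ) • blocks (ξ • A) Ω (-Ωᴴ) (ξ • B)))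

/-- Admissible initial angular velocities: skew-Hermitian matrices with zero diagonal. -/
def IsInitialVelocity {N : ℕ} (W : Matrix (Fin N) (Fin N) ℂ) : Prop :=
  Wᴴ = -W ∧ ∀ i, W i i = 0

/-! ### Matrix calculus, angular velocity and angular momentum. -/

section Calculus

open scoped Matrix.Norms.Operator

/-! The metric is a left-over of rigid body mechanics on U(N): with ω = u u̇†, the energy is -½ Re
tr(Lω), and L is a symmetric linear function of ω for the trace form. Varying a curve in the
direction η = u (∂ₛu)† changes the action by ∫ Re tr((L̇ - [L, ω]) η) plus boundary terms
(`hasDerivAt_flagAction`). At a fixed flag η is diagonal while L has zero diagonal, so the boundary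
terms vanish. The Euler equation is thus sufficient, after checking that it does not depend on the
phases of the frame (`EulerOn.congr_toFlag`). It is necessary because the trace form is definite on
skew-Hermitian matrices (`EulerOn.of_isGeodesicOn`).

The Euler equation makes K = u† L u constant. In the gauge ω_ii = 0 the momentum determines ω, since
all c_ij with i ≠ j are nonzero. So u solves a first-order equation u̇ = F(u) with F smooth, and is
fixed by u(0) and ω(0) (`eqOn_of_eulerOn`). Every smooth curve of flags has a lift in this gauge
(`exists_horizontal_lift`).

It remains to exhibit one solution for each W. Induction over the tree carries two identities, Ġ =
-ΩG and L(Ω)G = G L(W) (`BracketTree.exists_angularVelocity`). At a bracket with coefficient c, let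
h be the product of the two block-diagonal factors of G, and let M = L(W)/c. The factors exp(ξAt),
exp(ξBt) correct the inner solutions so that ḣ = (P - Ω)h, with P = L(Ω)/c = h M h†. Then G = h
exp(-tM) satisfies Ġ = (P - Ω)G - PG = -ΩG.

The tree exists because a laminar family of intervals always leaves a place to cut an interval in
two without separating the points of any bracket that does not contain it all
(`exists_cut_of_laminar`). -/

theorem contDiffOn_matrix_iff {E : Type*} [NormedAddCommGroup E] [NormedSpace ℝ E] {m n : ℕ}
    {f : E → Matrix (Fin m) (Fin n) ℂ} {s : Set E} {k : WithTop ℕ∞} :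
    ContDiffOn ℝ k f s ↔ ∀ i j, ContDiffOn ℝ k (fun x => f x i j) s := by
  constructor
  · intro h i j
    exact (LinearMap.toContinuousLinearMap
      (Matrix.entryLinearMap ℝ ℂ i j)).contDiff.comp_contDiffOn h
  · intro h
    have : f = fun x => ∑ i, ∑ j, (LinearMap.toContinuousLinearMap
        (Matrix.singleLinearMap ℝ i j : ℂ →ₗ[ℝ] Matrix (Fin m) (Fin n) ℂ)) (f x i j) := by
      funext x
      exact Matrix.matrix_eq_sum_single (f x)
    rw [this]
    exact ContDiffOn.sum fun i _ => ContDiffOn.sum fun j _ =>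
      (ContinuousLinearMap.contDiff _).comp_contDiffOn (h i j)

theorem hasDerivAt_matrix_iff {m n : ℕ} {f : ℝ → Matrix (Fin m) (Fin n) ℂ}
    {f' : Matrix (Fin m) (Fin n) ℂ} {t : ℝ} :
    HasDerivAt f f' t ↔ ∀ i j, HasDerivAt (fun x => f x i j) (f' i j) t := by
  constructor
  · intro h i j
    exact (LinearMap.toContinuousLinearMap
      (Matrix.entryLinearMap ℝ ℂ i j)).hasFDerivAt.comp_hasDerivAt t h
  · intro h
    have key : ∀ g : Matrix (Fin m) (Fin n) ℂ, g = ∑ i, ∑ j, (LinearMap.toContinuousLinearMap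
        (Matrix.singleLinearMap ℝ i j : ℂ →ₗ[ℝ] Matrix (Fin m) (Fin n) ℂ)) (g i j) :=
      fun g => Matrix.matrix_eq_sum_single g
    rw [show f = _ from funext fun x => key (f x), key f']
    exact HasDerivAt.fun_sum fun i _ => HasDerivAt.fun_sum fun j _ =>
      (ContinuousLinearMap.hasFDerivAt _).comp_hasDerivAt t (h i j)

theorem HasDerivAt.matrix_conjTranspose {m n : ℕ} {f : ℝ → Matrix (Fin m) (Fin n) ℂ}
    {f' : Matrix (Fin m) (Fin n) ℂ} {t : ℝ} (h : HasDerivAt f f' t) :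
    HasDerivAt (fun x => (f x)ᴴ) f'ᴴ t := by
  rw [hasDerivAt_matrix_iff] at h ⊢
  exact fun i j => (h j i).star

theorem ContDiffOn.matrix_conjTranspose {E : Type*} [NormedAddCommGroup E] [NormedSpace ℝ E]
    {m n : ℕ} {f : E → Matrix (Fin m) (Fin n) ℂ} {s : Set E} {k : WithTop ℕ∞}
    (h : ContDiffOn ℝ k f s) : ContDiffOn ℝ k (fun x => (f x)ᴴ) s := by
  rw [contDiffOn_matrix_iff] at h ⊢
  exact fun i j => (starL' ℝ : ℂ ≃L[ℝ] ℂ).contDiff.comp_contDiffOn (h j i)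

theorem smoothFrameOn_iff {E : Type*} [NormedAddCommGroup E] [NormedSpace ℝ E] {N : ℕ}
    {u : E → Matrix.unitaryGroup (Fin N) ℂ} {s : Set E} :
    SmoothFrameOn u s ↔ ContDiffOn ℝ ∞ (fun x => (u x).1) s :=
  contDiffOn_matrix_iff.symm

theorem frame_mul_conjTranspose {N : ℕ} (u : Matrix.unitaryGroup (Fin N) ℂ) :
    u.1 * u.1ᴴ = 1 := Matrix.mem_unitaryGroup_iff.1 u.2

theorem conjTranspose_mul_frame {N : ℕ} (u : Matrix.unitaryGroup (Fin N) ℂ) :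
    u.1ᴴ * u.1 = 1 := Matrix.mem_unitaryGroup_iff'.1 u.2

theorem hprod_eq {N : ℕ} (x y : Matrix (Fin N) (Fin N) ℂ) (i j : Fin N) :
    hprod (x i) (y j) = (y * xᴴ) j i := by
  simp [hprod, Matrix.mul_apply, mul_comm]

theorem velocity_eq {N : ℕ} {u : ℝ → Matrix.unitaryGroup (Fin N) ℂ} {t : ℝ}
    {V : Matrix (Fin N) (Fin N) ℂ} (h : HasDerivAt (fun τ => (u τ).1) V t) :
    velocity u t = V := by
  funext i k
  exact (hasDerivAt_matrix_iff.1 h i k).deriv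

/-- Frames are rows, so ω = u u̇† and consequently u̇ = -ωu. This is the source of the minus signs
in the exponentials of the solution. -/
theorem angularVelocity_eq {N : ℕ} {u : ℝ → Matrix.unitaryGroup (Fin N) ℂ} {t : ℝ}
    {V : Matrix (Fin N) (Fin N) ℂ} (h : HasDerivAt (fun τ => (u τ).1) V t) :
    angularVelocity u t = (u t).1 * Vᴴ := by
  ext i j
  rw [angularVelocity, velocity_eq h, Matrix.of_apply, hprod_eq]

theorem frame_mul_conjTranspose_deriv {N : ℕ} {u : ℝ → Matrix.unitaryGroup (Fin N) ℂ} {t : ℝ}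
    {V : Matrix (Fin N) (Fin N) ℂ} (h : HasDerivAt (fun τ => (u τ).1) V t) :
    V * (u t).1ᴴ + (u t).1 * Vᴴ = 0 := by
  have h1 := h.mul h.matrix_conjTranspose
  have h2 : ((fun τ => (u τ).1) * fun τ => (u τ).1ᴴ) = fun _ => 1 :=
    funext fun τ => frame_mul_conjTranspose (u τ)
  rw [h2] at h1
  exact h1.unique (hasDerivAt_const t _)

theorem velocity_eq_neg_angularVelocity_mul {N : ℕ} {u : ℝ → Matrix.unitaryGroup (Fin N) ℂ}
    {t : ℝ} {V : Matrix (Fin N) (Fin N) ℂ} (h : HasDerivAt (fun τ => (u τ).1) V t) :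
    V = -angularVelocity u t * (u t).1 := by
  rw [angularVelocity_eq h, ← eq_neg_of_add_eq_zero_left (frame_mul_conjTranspose_deriv h),
    mul_assoc, conjTranspose_mul_frame, mul_one]

theorem angularVelocity_conjTranspose {N : ℕ} {u : ℝ → Matrix.unitaryGroup (Fin N) ℂ} {t : ℝ}
    {V : Matrix (Fin N) (Fin N) ℂ} (h : HasDerivAt (fun τ => (u τ).1) V t) :
    (angularVelocity u t)ᴴ = -angularVelocity u t := by
  rw [angularVelocity_eq h, Matrix.conjTranspose_mul, Matrix.conjTranspose_conjTranspose]
  exact eq_neg_of_add_eq_zero_left (frame_mul_conjTranspose_deriv h)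

theorem horizontal_iff {N : ℕ} {u : ℝ → Matrix.unitaryGroup (Fin N) ℂ} {t : ℝ}
    {V : Matrix (Fin N) (Fin N) ℂ} (h : HasDerivAt (fun τ => (u τ).1) V t) :
    (∀ i, hprod ((u t).1 i) (velocity u t i) = 0) ↔ ∀ i, angularVelocity u t i i = 0 := by
  refine forall_congr' fun i => ?_
  rw [velocity_eq h, hprod_eq, angularVelocity_eq h,
    eq_neg_of_add_eq_zero_left (frame_mul_conjTranspose_deriv h)]
  simp

theorem SmoothFrameOn.hasDerivAt {N : ℕ} {u : ℝ → Matrix.unitaryGroup (Fin N) ℂ} {J : Set ℝ}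
    (hJ : IsOpen J) (hu : SmoothFrameOn u J) {t : ℝ} (ht : t ∈ J) :
    HasDerivAt (fun τ => (u τ).1) (deriv (fun τ => (u τ).1) t) t :=
  (((smoothFrameOn_iff.1 hu).contDiffAt (hJ.mem_nhds ht)).differentiableAt (by simp)).hasDerivAt

theorem SmoothFrameOn.contDiffOn_deriv {N : ℕ} {u : ℝ → Matrix.unitaryGroup (Fin N) ℂ}
    {J : Set ℝ} (hJ : IsOpen J) (hu : SmoothFrameOn u J) :
    ContDiffOn ℝ ∞ (deriv fun τ => (u τ).1) J :=
  (smoothFrameOn_iff.1 hu).deriv_of_isOpen hJ (by simp)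

theorem SmoothFrameOn.contDiffOn_angularVelocity {N : ℕ}
    {u : ℝ → Matrix.unitaryGroup (Fin N) ℂ} {J : Set ℝ} (hJ : IsOpen J)
    (hu : SmoothFrameOn u J) : ContDiffOn ℝ ∞ (angularVelocity u) J :=
  ((smoothFrameOn_iff.1 hu).mul (hu.contDiffOn_deriv hJ).matrix_conjTranspose).congr
    fun _ ht => angularVelocity_eq (hu.hasDerivAt hJ ht)

/-- The angular momentum as a real-linear function of the angular velocity. -/
noncomputable def momentumMap {N : ℕ} (c : Fin N → Fin N → ℝ) :
    Matrix (Fin N) (Fin N) ℂ →L[ℝ] Matrix (Fin N) (Fin N) ℂ :=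
  LinearMap.toContinuousLinearMap
    { toFun := angularMomentum c
      map_add' := fun x y => by
        ext i j
        by_cases h : i = j <;> simp [angularMomentum, h, mul_add]
      map_smul' := fun r x => by
        ext i j
        by_cases h : i = j <;> simp [angularMomentum, h, mul_left_comm] }

theorem momentumMap_apply {N : ℕ} (c : Fin N → Fin N → ℝ) (x : Matrix (Fin N) (Fin N) ℂ) :
    momentumMap c x = angularMomentum c x := rfl

theorem angularMomentum_conjTranspose {N : ℕ} {c : Fin N → Fin N → ℝ}
    (hc : ∀ i j, c i j = c j i) {x : Matrix (Fin N) (Fin N) ℂ} (hx : xᴴ = -x) :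
    (angularMomentum c x)ᴴ = -angularMomentum c x := by
  ext i j
  have h : star (x j i) = -x i j := congrFun (congrFun hx i) j
  by_cases hij : i = j
  · simp [angularMomentum, hij]
  · simp only [angularMomentum, Matrix.conjTranspose_apply, Matrix.of_apply, Ne.symm hij, hij,
      if_false, Matrix.neg_apply, star_mul', h, hc j i]
    simp

/-- Self-adjointness of the inertia operator for the trace form, which merges the two halves of the
derivative of tr(Lω). -/
theorem trace_angularMomentum_mul {N : ℕ} {c : Fin N → Fin N → ℝ}
    (hc : ∀ i j, c i j = c j i) (x y : Matrix (Fin N) (Fin N) ℂ) :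
    (angularMomentum c x * y).trace = (angularMomentum c y * x).trace := by
  simp only [Matrix.trace, Matrix.diag_apply, Matrix.mul_apply]
  rw [Finset.sum_comm]
  refine Finset.sum_congr rfl fun i _ => Finset.sum_congr rfl fun j _ => ?_
  by_cases hij : i = j
  · simp [angularMomentum, hij]
  · simp only [angularMomentum, Matrix.of_apply, hij, Ne.symm hij, if_false, hc j i]
    ring

/-- This kills the boundary terms of the first variation: a variation that fixes a flag only moves
the phases. -/
theorem angularMomentum_mul_eq_zero_of_isDiag {N : ℕ} (c : Fin N → Fin N → ℝ)
    (x : Matrix (Fin N) (Fin N) ℂ) {y : Matrix (Fin N) (Fin N) ℂ} (hy : ∀ i j, i ≠ j → y i j = 0) :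
    (angularMomentum c x * y).trace = 0 := by
  simp only [Matrix.trace, Matrix.diag_apply, Matrix.mul_apply]
  refine Finset.sum_eq_zero fun i _ => Finset.sum_eq_zero fun j _ => ?_
  by_cases hij : j = i
  · simp [angularMomentum, hij]
  · simp [hy j i hij]

theorem eulerOn_iff {N : ℕ} (c : Fin N → Fin N → ℝ) (u : ℝ → Matrix.unitaryGroup (Fin N) ℂ)
    (J : Set ℝ) : EulerOn c u J ↔ ∀ t ∈ J,
      HasDerivAt (fun τ => angularMomentum c (angularVelocity u τ))
        ⁅angularMomentum c (angularVelocity u t), angularVelocity u t⁆ t :=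
  forall₂_congr fun _ _ => hasDerivAt_matrix_iff.symm

theorem NestedDiagram.metric_comm {N : ℕ} (D : NestedDiagram N) (i j : Fin N) :
    D.metric i j = D.metric j i := by
  simp only [NestedDiagram.metric, and_comm]

end Calculus

/-! ### Two-parameter families: mixed derivatives and differentiation under the integral. -/

section PartialDerivatives

open Set MeasureTheory Topology

variable {F : Type*} [NormedAddCommGroup F] [NormedSpace ℝ F]

theorem hasDerivAt_fst_of_contDiffOn {f : ℝ × ℝ → F} {O : Set (ℝ × ℝ)} (hO : IsOpen O)
    (hf : ContDiffOn ℝ ∞ f O) {s t : ℝ} (h : (s, t) ∈ O) :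
    HasDerivAt (fun x => f (x, t)) (fderiv ℝ f (s, t) (1, 0)) s :=
  ((hf.contDiffAt (hO.mem_nhds h)).differentiableAt (by simp)).hasFDerivAt.comp_hasDerivAt s
    ((hasDerivAt_id s).prodMk (hasDerivAt_const s t))

theorem hasDerivAt_snd_of_contDiffOn {f : ℝ × ℝ → F} {O : Set (ℝ × ℝ)} (hO : IsOpen O)
    (hf : ContDiffOn ℝ ∞ f O) {s t : ℝ} (h : (s, t) ∈ O) :
    HasDerivAt (fun x => f (s, x)) (fderiv ℝ f (s, t) (0, 1)) t :=
  ((hf.contDiffAt (hO.mem_nhds h)).differentiableAt (by simp)).hasFDerivAt.comp_hasDerivAt t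
    ((hasDerivAt_const t s).prodMk (hasDerivAt_id t))

theorem contDiffOn_fderiv_apply_const {f : ℝ × ℝ → F} {O : Set (ℝ × ℝ)} (hO : IsOpen O)
    (hf : ContDiffOn ℝ ∞ f O) (w : ℝ × ℝ) : ContDiffOn ℝ ∞ (fun p => fderiv ℝ f p w) O :=
  (hf.fderiv_of_isOpen hO (by simp)).clm_apply contDiffOn_const

theorem fderiv_fderiv_apply_comm {f : ℝ × ℝ → F} {O : Set (ℝ × ℝ)} (hO : IsOpen O)
    (hf : ContDiffOn ℝ ∞ f O) {p : ℝ × ℝ} (h : p ∈ O) (x y : ℝ × ℝ) :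
    fderiv ℝ (fun q => fderiv ℝ f q x) p y = fderiv ℝ (fun q => fderiv ℝ f q y) p x := by
  have hp := hf.contDiffAt (hO.mem_nhds h)
  have hd : DifferentiableAt ℝ (fderiv ℝ f) p :=
    ((hf.fderiv_of_isOpen (m := ∞) hO (by simp)).contDiffAt (hO.mem_nhds h)).differentiableAt
      (by simp)
  have key : ∀ z w, fderiv ℝ (fun q => fderiv ℝ f q z) p w = fderiv ℝ (fderiv ℝ f) p w z := by
    intro z w
    rw [fderiv_clm_apply hd (differentiableAt_const z)]
    simp
  rw [key, key]
  exact hp.isSymmSndFDerivAt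
    (by rw [minSmoothness_of_isRCLikeNormedField]; exact ENat.LEInfty.out) y x

theorem hasDerivAt_integral_of_contDiffOn_prod [CompleteSpace F] {f : ℝ × ℝ → F} {J : Set ℝ}
    (hJ : IsOpen J)
    (hf : ContDiffOn ℝ ∞ f (univ ×ˢ J)) {a b : ℝ} (hab : a ≤ b) (hI : Icc a b ⊆ J) (s₀ : ℝ) :
    HasDerivAt (fun s => ∫ t in a..b, f (s, t))
      (∫ t in a..b, fderiv ℝ f (s₀, t) (1, 0)) s₀ := by
  have hO : IsOpen (univ ×ˢ J : Set (ℝ × ℝ)) := isOpen_univ.prod hJ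
  have hf' := contDiffOn_fderiv_apply_const hO hf (1, 0)
  have hline : ∀ {g : ℝ × ℝ → F}, ContDiffOn ℝ ∞ g (univ ×ˢ J) → ∀ s,
      ContinuousOn (fun t => g (s, t)) (uIcc a b) := fun {g} hg s => by
    refine hg.continuousOn.comp (by fun_prop) fun t ht => ⟨mem_univ _, hI ?_⟩
    rwa [uIcc_of_le hab] at ht
  have hmeas : ∀ {g : ℝ × ℝ → F}, ContDiffOn ℝ ∞ g (univ ×ˢ J) → ∀ s,
      AEStronglyMeasurable (fun t => g (s, t)) (volume.restrict (uIoc a b)) :=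
    fun hg s => (intervalIntegrable_iff.1 (hline hg s).intervalIntegrable).aestronglyMeasurable
  -- The dominating function is a constant: the s-derivative is continuous, hence bounded on a
  -- compact box around s₀.
  obtain ⟨C, hC⟩ := (isCompact_Icc.prod isCompact_Icc :
    IsCompact (Icc (s₀ - 1) (s₀ + 1) ×ˢ Icc a b)).exists_bound_of_continuousOn
      (hf'.continuousOn.mono (prod_mono (subset_univ _) hI))
  refine (intervalIntegral.hasDerivAt_integral_of_dominated_loc_of_deriv_le
    (F := fun s t => f (s, t)) (F' := fun s t => fderiv ℝ f (s, t) (1, 0)) (bound := fun _ => C)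
    (Icc_mem_nhds (by linarith : s₀ - 1 < s₀) (by linarith : s₀ < s₀ + 1))
    (Filter.Eventually.of_forall fun s => hmeas hf s)
    (hline hf s₀).intervalIntegrable (hmeas hf' s₀) (Filter.Eventually.of_forall ?_)
    intervalIntegrable_const (Filter.Eventually.of_forall ?_)).2
  · intro t ht s hs
    rw [uIoc_of_le hab] at ht
    exact hC (s, t) ⟨hs, Ioc_subset_Icc_self ht⟩
  · intro t ht s _
    rw [uIoc_of_le hab] at ht
    exact hasDerivAt_fst_of_contDiffOn hO hf ⟨mem_univ _, hI (Ioc_subset_Icc_self ht)⟩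

end PartialDerivatives

/-! ### The first variation of the action. -/

section FirstVariation

open Set
open scoped Matrix.Norms.Operator

theorem sum_offDiag_eq_two_mul_sum_Iio {N : ℕ} {f : Fin N → Fin N → ℝ}
    (hf : ∀ i j, f i j = f j i) (h0 : ∀ i, f i i = 0) :
    ∑ i, ∑ j, f i j = 2 * ∑ i, ∑ j ∈ Finset.Iio i, f i j := by
  have h1 : ∀ i, ∑ j, f i j = ∑ j ∈ Finset.Iio i, f i j + ∑ j ∈ Finset.Ioi i, f i j := by
    intro i
    rw [← Finset.sum_union (Finset.disjoint_left.2 fun x hx hx' => by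
      simp only [Finset.mem_Iio, Finset.mem_Ioi] at hx hx'
      exact lt_asymm hx hx')]
    symm
    refine Finset.sum_subset (Finset.subset_univ _) fun x _ hx => ?_
    have : x = i := by
      by_contra hne
      rcases lt_or_gt_of_ne hne with h | h <;> simp [h] at hx
    rw [this, h0]
  have h2 : ∑ i, ∑ j ∈ Finset.Ioi i, f i j = ∑ i, ∑ j ∈ Finset.Iio i, f i j := by
    rw [Finset.sum_comm' (t' := Finset.univ) (s' := fun j => Finset.Iio j) (by simp)]
    exact Finset.sum_congr rfl fun i _ => Finset.sum_congr rfl fun j _ => hf j i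
  simp only [h1, Finset.sum_add_distrib, h2]
  ring

theorem metric_energy_eq {N : ℕ} {c : Fin N → Fin N → ℝ} (hc : ∀ i j, c i j = c j i)
    {x : Matrix (Fin N) (Fin N) ℂ} (hx : xᴴ = -x) :
    ∑ i, ∑ j ∈ Finset.Iio i, c i j * ‖x i j‖ ^ 2 =
      -(1 / 2) * (angularMomentum c x * x).trace.re := by
  have hx' : ∀ i j, x j i = -star (x i j) := fun i j => by
    have h : star (x i j) = -x j i := congrFun (congrFun hx j) i
    rw [h, neg_neg]
  -- The diagonal has to be masked, since neither c i i nor x i i need vanish for an arbitrary lift.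
  have h := sum_offDiag_eq_two_mul_sum_Iio
    (f := fun i j => if i = j then 0 else c i j * ‖x i j‖ ^ 2)
    (fun i j => by simp only [eq_comm (a := j), hc j i, hx' i j, norm_neg, norm_star]) (by simp)
  have h3 : ∑ i, ∑ j ∈ Finset.Iio i, c i j * ‖x i j‖ ^ 2 =
      ∑ i, ∑ j ∈ Finset.Iio i, if i = j then 0 else c i j * ‖x i j‖ ^ 2 :=
    Finset.sum_congr rfl fun i _ => Finset.sum_congr rfl fun j hj => by
      rw [if_neg (Finset.mem_Iio.1 hj).ne']
  have h4 : (angularMomentum c x * x).trace.re =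
      -∑ i, ∑ j, if i = j then 0 else c i j * ‖x i j‖ ^ 2 := by
    simp only [Matrix.trace, Matrix.diag_apply, Matrix.mul_apply, Complex.re_sum,
      ← Finset.sum_neg_distrib]
    refine Finset.sum_congr rfl fun i _ => Finset.sum_congr rfl fun j _ => ?_
    by_cases hij : i = j
    · simp [angularMomentum, hij]
    · simp only [angularMomentum, Matrix.of_apply, hij, if_false, hx' i j, mul_neg,
        Complex.neg_re, mul_assoc, Complex.star_def, Complex.mul_conj, Complex.normSq_eq_norm_sq]
      norm_cast
  rw [h3, h4, h]
  ring

theorem flagAction_eq {N : ℕ} {c : Fin N → Fin N → ℝ} (hc : ∀ i j, c i j = c j i) {a b : ℝ}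
    {u : ℝ → Matrix.unitaryGroup (Fin N) ℂ} {V : ℝ → Matrix (Fin N) (Fin N) ℂ}
    (h : ∀ t ∈ uIcc a b, HasDerivAt (fun τ => (u τ).1) (V t) t) :
    flagAction c a b u = ∫ t in a..b, -(1 / 2) *
      (angularMomentum c ((u t).1 * (V t)ᴴ) * ((u t).1 * (V t)ᴴ)).trace.re := by
  refine intervalIntegral.integral_congr fun t ht => ?_
  have hd := h t ht
  have hω := angularVelocity_eq hd
  have key := metric_energy_eq hc (angularVelocity_conjTranspose hd)
  rw [hω] at key
  refine Eq.trans ?_ key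
  refine Finset.sum_congr rfl fun i _ => Finset.sum_congr rfl fun j _ => ?_
  rw [velocity_eq hd, hprod_eq, eq_neg_of_add_eq_zero_left (frame_mul_conjTranspose_deriv hd),
    Matrix.neg_apply, norm_neg]

/-- The real part of the trace as a real-linear function. -/
noncomputable def reTrace (N : ℕ) : Matrix (Fin N) (Fin N) ℂ →L[ℝ] ℝ :=
  LinearMap.toContinuousLinearMap (Complex.reLm ∘ₗ Matrix.traceLinearMap (Fin N) ℝ ℂ)

/-- Pointwise, the s-derivative of the Lagrangian is -Re tr(L ∂ₛω). The zero-curvature identity ∂ₛω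
= ∂ₜη + [ω, η] turns it into Re tr((L̇ - [L, ω])η) minus the total derivative of Re tr(Lη). The
boundary terms are kept, so no end-point condition is needed here. -/
theorem hasDerivAt_flagAction {N : ℕ} {c : Fin N → Fin N → ℝ} (hc : ∀ i j, c i j = c j i)
    {J : Set ℝ} (hJ : IsOpen J) {v : ℝ × ℝ → Matrix.unitaryGroup (Fin N) ℂ}
    (hv : SmoothFrameOn v (univ ×ˢ J)) {a b : ℝ} (hab : a ≤ b) (hI : Icc a b ⊆ J)
    {Ω η : ℝ → Matrix (Fin N) (Fin N) ℂ} (hω : Ω = angularVelocity fun t => v (0, t))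
    (hη : η = fun t => angularVelocity (fun s => v (s, t)) 0) :
    HasDerivAt (fun s => flagAction c a b fun t => v (s, t))
      ((∫ t in a..b, ((deriv (fun τ => angularMomentum c (Ω τ)) t -
        ⁅angularMomentum c (Ω t), Ω t⁆) * η t).trace.re) -
        ((angularMomentum c (Ω b) * η b).trace.re - (angularMomentum c (Ω a) * η a).trace.re))
      0 := by
  have hO : IsOpen (univ ×ˢ J : Set (ℝ × ℝ)) := isOpen_univ.prod hJ
  set V : ℝ × ℝ → Matrix (Fin N) (Fin N) ℂ := fun p => (v p).1 with hVdef
  have hV : ContDiffOn ℝ ∞ V (univ ×ˢ J) := smoothFrameOn_iff.1 hv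
  set Vs := fun p => fderiv ℝ V p (1, 0)
  set Vt := fun p => fderiv ℝ V p (0, 1)
  have hVs : ContDiffOn ℝ ∞ Vs (univ ×ˢ J) := contDiffOn_fderiv_apply_const hO hV (1, 0)
  have hVt : ContDiffOn ℝ ∞ Vt (univ ×ˢ J) := contDiffOn_fderiv_apply_const hO hV (0, 1)
  set w := fun p => V p * (Vt p)ᴴ
  set e := fun p => V p * (Vs p)ᴴ
  have hw : ContDiffOn ℝ ∞ w (univ ×ˢ J) := hV.mul hVt.matrix_conjTranspose
  have he : ContDiffOn ℝ ∞ e (univ ×ˢ J) := hV.mul hVs.matrix_conjTranspose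
  have hmem : ∀ s, ∀ t ∈ J, (s, t) ∈ (univ ×ˢ J : Set (ℝ × ℝ)) := fun s t ht => ⟨mem_univ s, ht⟩
  have hds : ∀ t ∈ J, HasDerivAt (fun s => V (s, t)) (Vs (0, t)) 0 := fun t ht =>
    hasDerivAt_fst_of_contDiffOn hO hV (hmem 0 t ht)
  have hdt : ∀ s, ∀ t ∈ J, HasDerivAt (fun τ => V (s, τ)) (Vt (s, t)) t := fun s t ht =>
    hasDerivAt_snd_of_contDiffOn hO hV (hmem s t ht)
  have hωw : ∀ t ∈ J, Ω t = w (0, t) := fun t ht => by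
    rw [hω]; exact angularVelocity_eq (u := fun t => v (0, t)) (hdt 0 t ht)
  have hηe : ∀ t ∈ J, η t = e (0, t) := fun t ht => by
    rw [hη]; exact angularVelocity_eq (u := fun s => v (s, t)) (hds t ht)
  have hcurve : ∀ {G : ℝ × ℝ → Matrix (Fin N) (Fin N) ℂ}, ContDiffOn ℝ ∞ G (univ ×ˢ J) →
      ContDiffOn ℝ ∞ (fun t => G (0, t)) J := fun hG =>
    hG.comp (by fun_prop) fun t ht => hmem 0 t ht
  have hωs : ContDiffOn ℝ ∞ Ω J := (hcurve hw).congr hωw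
  have hηs : ContDiffOn ℝ ∞ η J := (hcurve he).congr hηe
  have hLs : ContDiffOn ℝ ∞ (fun t => angularMomentum c (Ω t)) J :=
    (momentumMap c).contDiff.comp_contDiffOn hωs
  set F : ℝ × ℝ → ℝ := fun p => -(1 / 2) * (angularMomentum c (w p) * w p).trace.re
  have hF : ContDiffOn ℝ ∞ F (univ ×ˢ J) :=
    contDiffOn_const.mul ((reTrace N).contDiff.comp_contDiffOn
      (((momentumMap c).contDiff.comp_contDiffOn hw).mul hw))
  have hact : (fun s => flagAction c a b fun t => v (s, t)) = fun s => ∫ t in a..b, F (s, t) := by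
    funext s
    exact flagAction_eq hc fun t ht => hdt s t (hI (by rwa [uIcc_of_le hab] at ht))
  rw [hact]
  set B : ℝ → ℝ := fun t => (angularMomentum c (Ω t) * η t).trace.re
  have hB : ContDiffOn ℝ ∞ B J := (reTrace N).contDiff.comp_contDiffOn (hLs.mul hηs)
  have hBd : ∀ t ∈ J, HasDerivAt B (deriv B t) t := fun t ht =>
    ((hB.contDiffAt (hJ.mem_nhds ht)).differentiableAt (by simp)).hasDerivAt
  have hBc : ContinuousOn (deriv B) (uIcc a b) := by
    rw [uIcc_of_le hab]
    exact (hB.deriv_of_isOpen (m := ∞) hJ (by simp)).continuousOn.mono hI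
  set K : ℝ → ℝ := fun t => ((deriv (fun τ => angularMomentum c (Ω τ)) t -
        ⁅angularMomentum c (Ω t), Ω t⁆) * η t).trace.re with hKdef
  have hK : ContinuousOn K (uIcc a b) := by
    rw [uIcc_of_le hab]
    have h1 := (((hLs.deriv_of_isOpen (m := ∞) hJ (by simp)).sub
      ((hLs.mul hωs).sub (hωs.mul hLs))).mul hηs)
    exact ((reTrace N).contDiff.comp_contDiffOn h1).continuousOn.mono hI
  have hpt : ∀ t ∈ J, fderiv ℝ F (0, t) (1, 0) = K t - deriv B t := by
    intro t ht
    have hp := hmem 0 t ht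
    have hLd : HasDerivAt (fun τ => angularMomentum c (Ω τ))
        (deriv (fun τ => angularMomentum c (Ω τ)) t) t :=
      ((hLs.contDiffAt (hJ.mem_nhds ht)).differentiableAt (by simp)).hasDerivAt
    set E := deriv (fun τ => angularMomentum c (Ω τ)) t
    set M := fderiv ℝ Vt (0, t) (1, 0)
    -- Equality of mixed partials gives ∂ₛω and ∂ₜη the common summand V M†, which cancels in their
    -- difference.
    have hM : fderiv ℝ Vs (0, t) (0, 1) = M := fderiv_fderiv_apply_comm hO hV hp _ _
    have hwd : HasDerivAt (fun s => w (s, t)) (Vs (0, t) * (Vt (0, t))ᴴ + V (0, t) * Mᴴ) 0 :=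
      (hds t ht).mul (hasDerivAt_fst_of_contDiffOn hO hVt hp).matrix_conjTranspose
    have hed : HasDerivAt η (Vt (0, t) * (Vs (0, t))ᴴ + V (0, t) * Mᴴ) t := by
      have h1 := (hdt 0 t ht).mul
        ((hasDerivAt_snd_of_contDiffOn hO hVs hp).congr_deriv hM).matrix_conjTranspose
      refine h1.congr_of_eventuallyEq ?_
      filter_upwards [hJ.mem_nhds ht] with τ hτ using hηe τ hτ
    have hFd := ((reTrace N).hasFDerivAt.comp_hasDerivAt (0 : ℝ)
      (((momentumMap c).hasFDerivAt.comp_hasDerivAt (0 : ℝ) hwd).mul hwd)).const_mul (-(1 / 2))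
    have hBd' := (reTrace N).hasFDerivAt.comp_hasDerivAt t (hLd.mul hed)
    have e1 := (hasDerivAt_fst_of_contDiffOn hO hF hp).unique hFd
    have e2 := (hBd t ht).unique hBd'
    have r1 : Vs (0, t) * (V (0, t))ᴴ = -e (0, t) :=
      eq_neg_of_add_eq_zero_left (frame_mul_conjTranspose_deriv (u := fun s => v (s, t)) (hds t ht))
    have r2 : Vt (0, t) * (V (0, t))ᴴ = -w (0, t) :=
      eq_neg_of_add_eq_zero_left
        (frame_mul_conjTranspose_deriv (u := fun τ => v (0, τ)) (hdt 0 t ht))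
    have r3 : (V (0, t))ᴴ * V (0, t) = 1 := conjTranspose_mul_frame _
    -- Inserting V†V = 1 writes the remaining summands as -ηω and -ωη, whose difference is the
    -- commutator [ω, η].
    have q1 : Vs (0, t) * (Vt (0, t))ᴴ = -e (0, t) * w (0, t) := by
      rw [← r1]
      simp only [w]
      rw [mul_assoc, ← mul_assoc (V (0, t))ᴴ, r3, one_mul]
    have q2 : Vt (0, t) * (Vs (0, t))ᴴ = -w (0, t) * e (0, t) := by
      rw [← r2]
      simp only [e]
      rw [mul_assoc, ← mul_assoc (V (0, t))ᴴ, r3, one_mul]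
    rw [e1, e2, q1, q2]
    simp only [hKdef, momentumMap_apply, Function.comp_apply, hωw t ht, hηe t ht]
    change -(1 / 2) * (angularMomentum c _ * w (0, t) +
        angularMomentum c (w (0, t)) * _).trace.re = _ -
      (E * e (0, t) + angularMomentum c (w (0, t)) * _).trace.re
    rw [Matrix.trace_add, trace_angularMomentum_mul hc]
    set L := angularMomentum c (w (0, t))
    set W := w (0, t)
    set H := e (0, t)
    set P := V (0, t) * Mᴴ
    have hcyc : (L * (H * W)).trace = (W * L * H).trace := by
      rw [← mul_assoc, Matrix.trace_mul_cycle]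
    simp only [Ring.lie_def, sub_mul, mul_add, neg_mul, mul_neg, Matrix.trace_add,
      Matrix.trace_sub, Matrix.trace_neg, Complex.add_re, Complex.sub_re, Complex.neg_re, hcyc,
      mul_assoc]
    ring
  have hint := hasDerivAt_integral_of_contDiffOn_prod hJ hF hab hI 0
  refine hint.congr_deriv (Eq.symm ?_)
  rw [← intervalIntegral.integral_eq_sub_of_hasDerivAt
    (fun t ht => hBd t (hI (by rwa [uIcc_of_le hab] at ht))) hBc.intervalIntegrable,
    ← intervalIntegral.integral_sub hK.intervalIntegrable hBc.intervalIntegrable]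
  refine intervalIntegral.integral_congr fun t ht => ?_
  exact (hpt t (hI (by rwa [uIcc_of_le hab] at ht))).symm

end FirstVariation

/-! ### Geodesics and the Euler equation. -/

section EulerEquation

open Set
open scoped Matrix.Norms.Operator

theorem toFlag_eq_iff {N : ℕ} {u w : Matrix.unitaryGroup (Fin N) ℂ} :
    toFlag u = toFlag w ↔
      ∃ d : Fin N → ℂ, (∀ i, ‖d i‖ = 1) ∧ u.1 = Matrix.diagonal d * w.1 := by
  refine Quotient.eq.trans (exists_congr fun d => and_congr_right fun _ => ?_)
  rw [← Matrix.ext_iff]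
  simp [Matrix.diagonal_mul]

theorem isDiag_of_toFlag_eq {N : ℕ} {u w : Matrix.unitaryGroup (Fin N) ℂ}
    (h : toFlag u = toFlag w) : (u.1 * w.1ᴴ).IsDiag := by
  obtain ⟨d, -, hd⟩ := toFlag_eq_iff.1 h
  rw [hd, mul_assoc, frame_mul_conjTranspose, mul_one]
  exact Matrix.isDiag_diagonal d

/-- Equality of flags is used throughout as diagonality of u w†. That condition is linear and passes
to derivatives, so smooth phases need not be chosen separately. -/
theorem isDiag_of_hasDerivAt {N : ℕ} {D : ℝ → Matrix (Fin N) (Fin N) ℂ}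
    {D' : Matrix (Fin N) (Fin N) ℂ} {t : ℝ} (hD : HasDerivAt D D' t)
    (h : ∀ᶠ τ in nhds t, (D τ).IsDiag) : D'.IsDiag := by
  intro i j hij
  have h1 := hasDerivAt_matrix_iff.1 hD i j
  refine h1.unique ((hasDerivAt_const t (0 : ℂ)).congr_of_eventuallyEq ?_)
  filter_upwards [h] with τ hτ using hτ hij

theorem angularMomentum_of_isDiag {N : ℕ} (c : Fin N → Fin N → ℝ)
    {x : Matrix (Fin N) (Fin N) ℂ} (hx : x.IsDiag) : angularMomentum c x = 0 := by
  ext i j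
  by_cases hij : i = j
  · simp [angularMomentum, hij]
  · simp [angularMomentum, hx hij]

theorem angularMomentum_conj_isDiag {N : ℕ} (c : Fin N → Fin N → ℝ)
    (x : Matrix (Fin N) (Fin N) ℂ) {D : Matrix (Fin N) (Fin N) ℂ} (hD : D.IsDiag) :
    angularMomentum c (D * x * Dᴴ) = D * angularMomentum c x * Dᴴ := by
  rw [← (Matrix.isDiag_iff_diagonal_diag D).1 hD, Matrix.diagonal_conjTranspose]
  ext i j
  by_cases hij : i = j
  · simp [angularMomentum, hij, Matrix.diagonal_mul, Matrix.mul_diagonal]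
  · simp only [angularMomentum, hij, Matrix.diagonal_mul, Matrix.mul_diagonal, Matrix.of_apply,
      if_false]
    ring

/-- The Euler equation is invariant under time-dependent changes of the phases. -/
theorem EulerOn.congr_toFlag {N : ℕ} {c : Fin N → Fin N → ℝ} {J : Set ℝ} (hJ : IsOpen J)
    {u w : ℝ → Matrix.unitaryGroup (Fin N) ℂ} (hu : SmoothFrameOn u J) (hw : SmoothFrameOn w J)
    (hflag : ∀ t ∈ J, toFlag (w t) = toFlag (u t)) (he : EulerOn c u J) : EulerOn c w J := by
  rw [eulerOn_iff] at he ⊢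
  -- The phase matrix is recovered as w u†, which makes its smoothness automatic.
  set D : ℝ → Matrix (Fin N) (Fin N) ℂ := fun τ => (w τ).1 * (u τ).1ᴴ
  have hDd : ∀ t ∈ J, HasDerivAt D (deriv (fun τ => (w τ).1) t * (u t).1ᴴ +
      (w t).1 * (deriv (fun τ => (u τ).1) t)ᴴ) t := fun t ht =>
    (hw.hasDerivAt hJ ht).mul (hu.hasDerivAt hJ ht).matrix_conjTranspose
  set D' : ℝ → Matrix (Fin N) (Fin N) ℂ := fun t => deriv (fun τ => (w τ).1) t * (u t).1ᴴ +
      (w t).1 * (deriv (fun τ => (u τ).1) t)ᴴ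
  have hdiag : ∀ t ∈ J, (D t).IsDiag := fun t ht => isDiag_of_toFlag_eq (hflag t ht)
  have hdiag' : ∀ t ∈ J, (D' t).IsDiag := fun t ht => isDiag_of_hasDerivAt (hDd t ht) <| by
    filter_upwards [hJ.mem_nhds ht] with τ hτ using hdiag τ hτ
  have hDu : ∀ t, (D t)ᴴ * D t = 1 := fun t => by
    simp only [D, Matrix.conjTranspose_mul, Matrix.conjTranspose_conjTranspose]
    rw [mul_assoc, ← mul_assoc (w t).1ᴴ, conjTranspose_mul_frame, one_mul,
      frame_mul_conjTranspose]
  have hDu' : ∀ t, D t * (D t)ᴴ = 1 := fun t => mul_eq_one_comm.1 (hDu t)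
  have hskew : ∀ t ∈ J, D t * (D' t)ᴴ = -(D' t * (D t)ᴴ) := fun t ht => by
    have h1 := (hDd t ht).mul (hDd t ht).matrix_conjTranspose
    rw [show (D * fun τ => (D τ)ᴴ) = fun _ => 1 from funext hDu'] at h1
    exact eq_neg_of_add_eq_zero_right (h1.unique (hasDerivAt_const t _))
  have hωw : ∀ t ∈ J, angularVelocity w t =
      D t * (D' t)ᴴ + D t * angularVelocity u t * (D t)ᴴ := fun t ht => by
    have hwD : ∀ τ, (w τ).1 = D τ * (u τ).1 := fun τ => by
      simp only [D]
      rw [mul_assoc, conjTranspose_mul_frame, mul_one]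
    have h1 : HasDerivAt (fun τ => (w τ).1) (D' t * (u t).1 +
        D t * deriv (fun τ => (u τ).1) t) t := by
      rw [show (fun τ => (w τ).1) = fun τ => D τ * (u τ).1 from funext hwD]
      exact (hDd t ht).mul (hu.hasDerivAt hJ ht)
    rw [angularVelocity_eq h1, angularVelocity_eq (hu.hasDerivAt hJ ht), hwD t]
    simp only [Matrix.conjTranspose_add, Matrix.conjTranspose_mul, mul_add]
    rw [mul_assoc (D t), ← mul_assoc (u t).1, frame_mul_conjTranspose, one_mul]
    simp only [mul_assoc]
  -- The inhomogeneous gauge term D Ḋ† is diagonal, so the momentum does not see it and transforms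
  -- by conjugation.
  have hLw : ∀ t ∈ J, angularMomentum c (angularVelocity w t) =
      D t * angularMomentum c (angularVelocity u t) * (D t)ᴴ := fun t ht => by
    have h0 : (D t * (D' t)ᴴ).IsDiag := by
      have h1 := hdiag t ht
      have h2 := (hdiag' t ht).conjTranspose
      rw [← (Matrix.isDiag_iff_diagonal_diag _).1 h1, ← (Matrix.isDiag_iff_diagonal_diag _).1 h2,
        Matrix.diagonal_mul_diagonal]
      exact Matrix.isDiag_diagonal _
    rw [hωw t ht, ← momentumMap_apply, map_add, momentumMap_apply, momentumMap_apply,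
      angularMomentum_of_isDiag c h0, zero_add, angularMomentum_conj_isDiag c _ (hdiag t ht)]
  intro t ht
  -- Differentiating D L D† produces, besides D[L, ω]D†, the commutator of D L D† with D Ḋ†, which
  -- is exactly the gauge term's share of the new angular velocity.
  have h1 := (((hDd t ht).mul (he t ht)).mul (hDd t ht).matrix_conjTranspose)
  refine (h1.congr_of_eventuallyEq ?_).congr_deriv ?_
  · filter_upwards [hJ.mem_nhds ht] with τ hτ using hLw τ hτ
  · change (D' t * _ + D t * _) * (D t)ᴴ + D t * _ * (D' t)ᴴ = _
    rw [hLw t ht, hωw t ht]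
    set L := angularMomentum c (angularVelocity u t)
    set W := angularVelocity u t
    have e1 : ∀ x, (D t)ᴴ * (D t * x) = x := fun x => by rw [← mul_assoc, hDu, one_mul]
    rw [Ring.lie_def, Ring.lie_def, mul_add, add_mul (D t * (D' t)ᴴ), hskew t ht]
    rw [← neg_eq_iff_eq_neg.2 (hskew t ht)]
    simp only [neg_neg, mul_sub, sub_mul, add_mul, mul_assoc, e1]
    rw [← mul_assoc (D t) (D' t)ᴴ, hskew t ht]
    simp only [neg_mul, mul_assoc, e1]
    abel

theorem contDiff_matrix_exp {N : ℕ} :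
    ContDiff ℝ ∞ (NormedSpace.exp : Matrix (Fin N) (Fin N) ℂ → Matrix (Fin N) (Fin N) ℂ) :=
  contDiff_iff_contDiffAt.2 fun x => (NormedSpace.exp_analytic (𝕂 := ℝ) x).contDiffAt

theorem exp_mem_unitaryGroup {N : ℕ} {X : Matrix (Fin N) (Fin N) ℂ} (hX : Xᴴ = -X) :
    NormedSpace.exp X ∈ Matrix.unitaryGroup (Fin N) ℂ := by
  rw [Matrix.mem_unitaryGroup_iff, Matrix.star_eq_conjTranspose, ← Matrix.exp_conjTranspose, hX,
    ← Matrix.exp_add_of_commute _ _ (Commute.refl X).neg_right, add_neg_cancel,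
    NormedSpace.exp_zero]

theorem conjTranspose_real_smul {N : ℕ} {X : Matrix (Fin N) (Fin N) ℂ} (hX : Xᴴ = -X) (r : ℝ) :
    (r • X)ᴴ = -(r • X) := by
  rw [Matrix.conjTranspose_smul, hX, star_trivial, smul_neg]

theorem IsGeodesicOn.of_eulerOn {N : ℕ} {c : Fin N → Fin N → ℝ} (hc : ∀ i j, c i j = c j i)
    {J : Set ℝ} (hJ : IsOpen J) {u : ℝ → Matrix.unitaryGroup (Fin N) ℂ}
    (hu : SmoothFrameOn u J) (he : EulerOn c u J) :
    IsGeodesicOn c (fun t => toFlag (u t)) J := by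
  refine ⟨⟨u, hu, fun _ _ => rfl⟩, fun a b hab hI v hv h0 ha hb => ?_⟩
  have hO : IsOpen (univ ×ˢ J : Set (ℝ × ℝ)) := isOpen_univ.prod hJ
  have hv0 : SmoothFrameOn (fun t => v (0, t)) J := fun i k =>
    (hv i k).comp (g := fun p => (v p).1 i k) (f := fun t : ℝ => ((0 : ℝ), t)) (by fun_prop)
      fun t ht => ⟨mem_univ _, ht⟩
  -- The variation starts at some lift of the geodesic, not necessarily u, so the Euler equation is
  -- moved to that lift.
  have he0 := (eulerOn_iff _ _ _).1 (he.congr_toFlag hJ hu hv0 h0)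
  refine (hasDerivAt_flagAction hc hJ hv hab.le hI rfl rfl).congr_deriv ?_
  have hbdry : ∀ x ∈ J, (∀ s, toFlag (v (s, x)) = toFlag (u x)) →
      (angularVelocity (fun s => v (s, x)) 0).IsDiag := by
    intro x hx hfix
    have hd := hasDerivAt_fst_of_contDiffOn hO (smoothFrameOn_iff.1 hv)
      (show ((0 : ℝ), x) ∈ univ ×ˢ J from ⟨mem_univ _, hx⟩)
    rw [angularVelocity_eq (u := fun s => v (s, x)) hd]
    -- At a fixed end point η is the s-derivative of v(0, x) v(s, x)†, which is diagonal for every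
    -- s.
    refine isDiag_of_hasDerivAt (hd.matrix_conjTranspose.const_mul (v (0, x)).1)
      (Filter.Eventually.of_forall fun s => isDiag_of_toFlag_eq ?_)
    rw [hfix, hfix]
  rw [angularMomentum_mul_eq_zero_of_isDiag c _
      fun i j hij => hbdry a (hI (left_mem_Icc.2 hab.le)) ha hij,
    angularMomentum_mul_eq_zero_of_isDiag c _
      fun i j hij => hbdry b (hI (right_mem_Icc.2 hab.le)) hb hij,
    intervalIntegral.integral_congr (g := fun _ => (0 : ℝ))]
  · simp
  · intro t ht
    rw [uIcc_of_le hab.le] at ht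
    have h1 := (he0 t (hI ht)).deriv
    refine (congrArg (fun x => Complex.re (Matrix.trace ((x - _) * _))) h1).trans ?_
    rw [sub_self, zero_mul, Matrix.trace_zero, Complex.zero_re]

/-- For skew-Hermitian X, -tr(X²) = tr(X†X) is the sum of the |X_ij|². A nonzero Euler defect can
therefore be tested against itself. -/
theorem trace_mul_self_re_neg {N : ℕ} {X : Matrix (Fin N) (Fin N) ℂ} (hX : Xᴴ = -X)
    (h : X ≠ 0) : (X * X).trace.re < 0 := by
  have h1 : (X * X).trace = -(Xᴴ * X).trace := by rw [hX, neg_mul, Matrix.trace_neg, neg_neg]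
  have h2 : (Xᴴ * X).trace.re = ∑ i, ∑ j, ‖X j i‖ ^ 2 := by
    simp only [Matrix.trace, Matrix.diag_apply, Matrix.mul_apply, Complex.re_sum,
      Matrix.conjTranspose_apply, Complex.star_def, ← Complex.normSq_eq_conj_mul_self,
      Complex.normSq_eq_norm_sq, Complex.ofReal_re]
  rw [h1, Complex.neg_re, h2, neg_lt_zero]
  obtain ⟨j, i, hij⟩ : ∃ j i, X j i ≠ 0 := by
    by_contra! hne
    exact h (Matrix.ext hne)
  refine Finset.sum_pos' (fun _ _ => Finset.sum_nonneg fun _ _ => by positivity)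
    ⟨i, Finset.mem_univ _, Finset.sum_pos' (fun _ _ => by positivity)
      ⟨j, Finset.mem_univ _, by positivity⟩⟩

/-- If the defect E = L̇ - [L, ω] has a nonzero value X at t₀, then Re tr(E(t)X) stays negative near
t₀, and a variation with η a positive multiple of X on a short interval makes the first variation
nonzero. -/
theorem EulerOn.of_isGeodesicOn {N : ℕ} {c : Fin N → Fin N → ℝ} (hc : ∀ i j, c i j = c j i)
    {J : Set ℝ} (hJ : IsOpen J) {u : ℝ → Matrix.unitaryGroup (Fin N) ℂ}
    (hu : SmoothFrameOn u J) (hg : IsGeodesicOn c (fun t => toFlag (u t)) J) :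
    EulerOn c u J := by
  rw [eulerOn_iff]
  intro t₀ ht₀
  have hΩ : ContDiffOn ℝ ∞ (angularVelocity u) J := hu.contDiffOn_angularVelocity hJ
  have hL : ContDiffOn ℝ ∞ (fun t => angularMomentum c (angularVelocity u t)) J :=
    (momentumMap c).contDiff.comp_contDiffOn hΩ
  have hLd : ∀ t ∈ J, HasDerivAt (fun τ => angularMomentum c (angularVelocity u τ))
      (deriv (fun τ => angularMomentum c (angularVelocity u τ)) t) t := fun t ht =>
    ((hL.contDiffAt (hJ.mem_nhds ht)).differentiableAt (by simp)).hasDerivAt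
  have hωskew : ∀ t ∈ J, (angularVelocity u t)ᴴ = -angularVelocity u t := fun t ht =>
    angularVelocity_conjTranspose (hu.hasDerivAt hJ ht)
  set E : ℝ → Matrix (Fin N) (Fin N) ℂ := fun t =>
    deriv (fun τ => angularMomentum c (angularVelocity u τ)) t -
      ⁅angularMomentum c (angularVelocity u t), angularVelocity u t⁆
  have hE : ContinuousOn E J := ((hL.deriv_of_isOpen (m := ∞) hJ (by simp)).sub
      ((hL.mul hΩ).sub (hΩ.mul hL))).continuousOn
  suffices h : E t₀ = 0 from sub_eq_zero.1 h ▸ hLd t₀ ht₀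
  by_contra hne
  set X := E t₀
  have hX : Xᴴ = -X := by
    have h1 : (deriv (fun τ => angularMomentum c (angularVelocity u τ)) t₀)ᴴ =
        -deriv (fun τ => angularMomentum c (angularVelocity u τ)) t₀ := by
      refine (hLd t₀ ht₀).matrix_conjTranspose.unique
        ((hLd t₀ ht₀).neg.congr_of_eventuallyEq ?_)
      filter_upwards [hJ.mem_nhds ht₀] with τ hτ
        using angularMomentum_conjTranspose hc (hωskew τ hτ)
    simp only [X, E]
    rw [Matrix.conjTranspose_sub, h1, Ring.lie_def, Matrix.conjTranspose_sub,
      Matrix.conjTranspose_mul, Matrix.conjTranspose_mul, hωskew t₀ ht₀,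
      angularMomentum_conjTranspose hc (hωskew t₀ ht₀)]
    simp only [neg_mul_neg]
    abel
  have hf : ContinuousAt (fun t => (E t * X).trace.re) t₀ :=
    ((reTrace N).continuous.comp_continuousOn (hE.mul continuousOn_const)).continuousAt
      (hJ.mem_nhds ht₀)
  have hev : ∀ᶠ t in nhds t₀, (E t * X).trace.re < 0 ∧ t ∈ J :=
    (hf.eventually_lt continuousAt_const (trace_mul_self_re_neg hX hne)).and (hJ.mem_nhds ht₀)
  obtain ⟨ε, hε, hball⟩ := Metric.nhds_basis_closedBall.mem_iff.1 hev
  rw [Real.closedBall_eq_Icc] at hball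
  set a := t₀ - ε
  set b := t₀ + ε
  have hab : a < b := by simp only [a, b]; linarith
  have hI : Icc a b ⊆ J := fun t ht => (hball ht).2
  -- The factor (t - a)(b - t) is positive inside and zero at both ends. No cutoff is needed, as
  -- only the flags at a and b have to stay fixed. The sign of X is chosen so that η = (t - a)(b -
  -- t)X.
  let v : ℝ × ℝ → Matrix.unitaryGroup (Fin N) ℂ := fun p =>
    ⟨NormedSpace.exp ((p.1 * ((p.2 - a) * (b - p.2))) • -X), exp_mem_unitaryGroup
      (conjTranspose_real_smul (by rw [Matrix.conjTranspose_neg, hX]) _)⟩ * u p.2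
  have hvv : ∀ p, (v p).1 =
      NormedSpace.exp ((p.1 * ((p.2 - a) * (b - p.2))) • -X) * (u p.2).1 := fun p => rfl
  have hv1 : ∀ s t, s * ((t - a) * (b - t)) = 0 → v (s, t) = u t := fun s t h => by
    apply Subtype.ext
    rw [hvv]
    simp [h]
  have hv : SmoothFrameOn v (univ ×ˢ J) := by
    rw [smoothFrameOn_iff]
    refine ContDiffOn.mul (contDiff_matrix_exp.comp ?_).contDiffOn
      ((smoothFrameOn_iff.1 hu).comp contDiffOn_snd fun p hp => hp.2)
    have h1 : ContDiff ℝ ∞ fun p : ℝ × ℝ => p.1 * ((p.2 - a) * (b - p.2)) := by fun_prop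
    exact h1.smul contDiff_const
  have hv0 : (fun t => v (0, t)) = u := funext fun t => hv1 0 t (by simp)
  have h1 := hg.2 a b hab hI v hv (fun t _ => by rw [hv1 0 t (by simp)])
    (fun s => by rw [hv1 s a (by simp)]) (fun s => by rw [hv1 s b (by simp)])
  have hη : ∀ t, angularVelocity (fun s => v (s, t)) 0 = ((t - a) * (b - t)) • X := by
    intro t
    have hd1 : HasDerivAt (fun s : ℝ => s * ((t - a) * (b - t))) ((t - a) * (b - t)) 0 := by
      simpa using (hasDerivAt_id (0 : ℝ)).mul_const ((t - a) * (b - t))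
    have hd2 : HasDerivAt (fun s => (v (s, t)).1)
        ((((t - a) * (b - t)) • -X) * (u t).1) 0 := by
      have h2 := (hasDerivAt_exp_smul_const (𝕂 := ℝ) (-X) (0 * ((t - a) * (b - t)))).scomp
        (0 : ℝ) hd1
      refine (h2.mul_const (u t).1).congr_deriv ?_
      simp
    rw [angularVelocity_eq (u := fun s => v (s, t)) hd2, hv1 0 t (by simp),
      Matrix.conjTranspose_mul, ← mul_assoc, frame_mul_conjTranspose, one_mul,
      Matrix.conjTranspose_smul, Matrix.conjTranspose_neg, hX, star_trivial, neg_neg]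
  have h2 := h1.unique (hasDerivAt_flagAction hc hJ hv hab.le hI rfl rfl)
  rw [hv0] at h2
  simp only [hη, sub_self, zero_mul, mul_zero, zero_smul, Matrix.trace_zero, Complex.zero_re,
    sub_zero] at h2
  have h3 : 0 < ∫ t in a..b, -(E t * ((t - a) * (b - t)) • X).trace.re := by
    refine intervalIntegral.intervalIntegral_pos_of_pos_on ?_ (fun t ht => ?_) hab
    · refine ContinuousOn.intervalIntegrable (ContinuousOn.neg
        ((reTrace N).continuous.comp_continuousOn (ContinuousOn.mul (hE.mono ?_)
          (by fun_prop : Continuous fun t => ((t - a) * (b - t)) • X).continuousOn)))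
      rwa [uIcc_of_le hab.le]
    · have h4 := (hball (Ioo_subset_Icc_self ht)).1
      have h5 : 0 < (t - a) * (b - t) := mul_pos (sub_pos.2 ht.1) (sub_pos.2 ht.2)
      rw [mul_smul_comm, Matrix.trace_smul, Complex.real_smul, Complex.re_ofReal_mul]
      linarith [mul_neg_of_pos_of_neg h5 h4]
  rw [intervalIntegral.integral_neg, ← h2] at h3
  simp at h3

end EulerEquation

/-! ### From laminar families of brackets to binary trees. -/

section BracketTrees

variable {R : Type*} {n k : ℕ} (A : Matrix (Fin n) (Fin n) R) (B : Matrix (Fin n) (Fin k) R)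
    (C : Matrix (Fin k) (Fin n) R) (D : Matrix (Fin k) (Fin k) R)

@[simp]
theorem blocks_castAdd_castAdd (i j : Fin n) :
    blocks A B C D (Fin.castAdd k i) (Fin.castAdd k j) = A i j := by
  simp [blocks]

@[simp]
theorem blocks_castAdd_natAdd (i : Fin n) (j : Fin k) :
    blocks A B C D (Fin.castAdd k i) (Fin.natAdd n j) = B i j := by
  simp [blocks]

@[simp]
theorem blocks_natAdd_castAdd (i : Fin k) (j : Fin n) :
    blocks A B C D (Fin.natAdd n i) (Fin.castAdd k j) = C i j := by
  simp [blocks]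

@[simp]
theorem blocks_natAdd_natAdd (i j : Fin k) :
    blocks A B C D (Fin.natAdd n i) (Fin.natAdd n j) = D i j := by
  simp [blocks]

theorem BracketTree.metric_comm {N : ℕ} (T : BracketTree N) (i j : Fin N) :
    T.metric i j = T.metric j i := by
  induction T with
  | leaf n c => rfl
  | node c T₁ T₂ h₁ h₂ =>
    refine Fin.addCases (fun i => ?_) (fun i => ?_) i <;>
      refine Fin.addCases (fun j => ?_) (fun j => ?_) j <;>
      simp [BracketTree.metric, h₁ _ _, h₂ _ _]

/-- In a laminar family of intervals, every interval `[p, p + n)` with at least two points can be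
cut in two so that only the members containing all of it meet both sides of the cut. -/
theorem exists_cut_of_laminar {𝓢 : Set (Set ℕ)} (hconn : ∀ S ∈ 𝓢, S.OrdConnected)
    (hlam : ∀ S ∈ 𝓢, ∀ S' ∈ 𝓢, S ⊆ S' ∨ S' ⊆ S ∨ Disjoint S S') (p : ℕ) {n : ℕ} (hn : 2 ≤ n) :
    ∃ k, k + 1 < n ∧ ∀ S ∈ 𝓢, p + k ∈ S → p + k + 1 ∈ S → Set.Ico p (p + n) ⊆ S := by
  by_contra! H
  -- If every cut fails, each gap lies in a member that misses part of the interval. Members over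
  -- consecutive gaps share a point, hence are nested, and the larger one reaches from p across
  -- both. At the last gap it contains the whole interval by convexity.
  have key : ∀ m, m + 1 < n →
      ∃ S ∈ 𝓢, p ∈ S ∧ p + m + 1 ∈ S ∧ ¬ Set.Ico p (p + n) ⊆ S := by
    intro m
    induction m with
    | zero =>
      intro hm
      exact H 0 hm
    | succ m ih =>
      intro hm
      obtain ⟨S, hS, h1, h2, h3⟩ := ih (by omega)
      obtain ⟨S', hS', h1', h2', h3'⟩ := H (m + 1) hm
      rcases hlam S hS S' hS' with h | h | h
      · exact ⟨S', hS', h h1, h2', h3'⟩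
      · exact ⟨S, hS, h1, h h2', h3⟩
      · exact absurd h1' (Set.disjoint_left.1 h h2)
  obtain ⟨S, hS, h1, h2, h3⟩ := key (n - 2) (by omega)
  refine h3 fun x hx => (hconn S hS).out h1 h2 ⟨hx.1, ?_⟩
  have := hx.2
  omega

/-- Strong induction on length. A bracket meeting both sides of the cut contains the whole interval,
so all pairs across the cut have the same coefficient, which becomes that of the new node. A bracket
with many parts is split repeatedly. -/
theorem NestedDiagram.exists_tree_on_interval {N : ℕ} (D : NestedDiagram N) (n : ℕ) :
    ∀ p, 1 ≤ n → (h : p + n ≤ N) → ∃ T : BracketTree n, ∀ i j : Fin n, i ≠ j →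
      T.metric i j = D.metric ⟨p + i, by omega⟩ ⟨p + j, by omega⟩ := by
  induction n using Nat.strong_induction_on with
  | _ n ih =>
  intro p hn h
  rcases Nat.lt_or_ge n 2 with hn2 | hn2
  · obtain rfl : n = 1 := by omega
    -- A single node has no pairs, so the coefficient 0 is a dummy value.
    exact ⟨.leaf 0 0, fun i j hij => absurd (Subsingleton.elim i j) hij⟩
  have hint : ∀ B ∈ D.brackets, (B : Set (Fin N)).OrdConnected := by
    intro B hB
    obtain ⟨I, K, -, rfl⟩ := D.interval B hB
    rw [Finset.coe_Icc]
    exact Set.ordConnected_Icc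
  obtain ⟨k, hk, hcut⟩ := exists_cut_of_laminar
    (𝓢 := {S | ∃ B ∈ D.brackets, S = (fun x : Fin N => (x : ℕ)) '' (B : Set (Fin N))})
    (by
      rintro _ ⟨B, hB, rfl⟩
      refine ⟨?_⟩
      rintro _ ⟨x, hx, rfl⟩ _ ⟨y, hy, rfl⟩ z hz
      exact ⟨⟨z, hz.2.trans_lt y.2⟩, (hint B hB).out hx hy ⟨hz.1, hz.2⟩, rfl⟩)
    (by
      rintro _ ⟨B, hB, rfl⟩ _ ⟨B', hB', rfl⟩
      rcases D.nested B hB B' hB' with h | h | h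
      · exact Or.inl (Set.image_mono (by exact_mod_cast h))
      · exact Or.inr (Or.inl (Set.image_mono (by exact_mod_cast h)))
      · exact Or.inr (Or.inr ((Set.disjoint_image_iff Fin.val_injective).2
          (by exact_mod_cast h)))) p hn2
  have hcut' : ∀ B ∈ D.brackets, ∀ x y : Fin N, (p ≤ x ∧ (x : ℕ) < p + k + 1) →
      (p + k + 1 ≤ y ∧ (y : ℕ) < p + n) → x ∈ B → y ∈ B →
      ∀ z : Fin N, p ≤ z → (z : ℕ) < p + n → z ∈ B := by
    -- By convexity, B contains the two neighbours p + k and p + k + 1 on either side of the cut.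
    intro B hB x y hx hy hxB hyB z hz1 hz2
    have hmem : ∀ w (hw : w < N), x ≤ (⟨w, hw⟩ : Fin N) → (⟨w, hw⟩ : Fin N) ≤ y →
        w ∈ (fun x : Fin N => (x : ℕ)) '' (B : Set (Fin N)) := fun w hw h1 h2 =>
      ⟨⟨w, hw⟩, (hint B hB).out hxB hyB ⟨h1, h2⟩, rfl⟩
    obtain ⟨z', hz', hzz⟩ := hcut _ ⟨B, hB, rfl⟩
      (hmem (p + k) (by omega) (by rw [Fin.le_def]; simp only; omega)
        (by rw [Fin.le_def]; simp only; omega))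
      (hmem (p + k + 1) (by omega) (by rw [Fin.le_def]; simp only; omega)
        (by rw [Fin.le_def]; simp only; omega)) ⟨hz1, hz2⟩
    rwa [← Fin.ext hzz]
  have hcross : ∀ x y : Fin N, (p ≤ x ∧ (x : ℕ) < p + k + 1) →
      (p + k + 1 ≤ y ∧ (y : ℕ) < p + n) →
      D.metric x y = D.metric ⟨p, by omega⟩ ⟨p + k + 1, by omega⟩ := by
    intro x y hx hy
    refine Finset.sum_congr (Finset.filter_congr fun B hB => ?_) fun _ _ => rfl
    constructor
    · rintro ⟨h1, h2⟩
      exact ⟨hcut' B hB x y hx hy h1 h2 _ le_rfl (by simp only; omega),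
        hcut' B hB x y hx hy h1 h2 _ (by simp only; omega) (by simp only; omega)⟩
    · rintro ⟨h1, h2⟩
      have h3 := hcut' B hB _ _ ⟨le_rfl, by simp only; omega⟩ ⟨le_rfl, by simp only; omega⟩ h1 h2
      exact ⟨h3 x hx.1 (by omega), h3 y (by omega) hy.2⟩
  obtain ⟨m, rfl⟩ : ∃ m, n = (k + 1) + m := ⟨n - (k + 1), by omega⟩
  obtain ⟨T₁, h₁⟩ := ih (k + 1) (by omega) p (by omega) (by omega)
  obtain ⟨T₂, h₂⟩ := ih m (by omega) (p + (k + 1)) (by omega) (by omega)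
  refine ⟨.node (D.metric ⟨p, by omega⟩ ⟨p + k + 1, by omega⟩) T₁ T₂, fun i j => ?_⟩
  refine Fin.addCases (fun i => ?_) (fun i => ?_) i <;>
    refine Fin.addCases (fun j => ?_) (fun j => ?_) j <;>
    intro hij <;> simp only [BracketTree.metric, blocks_castAdd_castAdd, blocks_castAdd_natAdd,
      blocks_natAdd_castAdd, blocks_natAdd_natAdd, Matrix.of_apply]
  · exact h₁ i j fun h => hij (by rw [h])
  · refine (hcross _ _ ⟨?_, ?_⟩ ⟨?_, ?_⟩).symm <;> simp <;> omega
  · refine ((D.metric_comm _ _).trans (hcross _ _ ⟨?_, ?_⟩ ⟨?_, ?_⟩)).symm <;> simp <;> omega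
  · rw [h₂ i j fun h => hij (by rw [h])]
    simp only [Fin.val_natAdd, add_assoc]

theorem NestedDiagram.exists_tree {N : ℕ} (hN : 1 ≤ N) (D : NestedDiagram N) :
    ∃ T : BracketTree N, T.Represents D := by
  obtain ⟨T, hT⟩ := D.exists_tree_on_interval N 0 hN (by omega)
  refine ⟨T, fun i j hij => ?_⟩
  simpa using hT i j hij

end BracketTrees

/-! ### Algebra and calculus of block matrices. -/

section BlockAlgebra

open scoped Matrix.Norms.Operator

variable {n k : ℕ}

theorem blocks_mul_blocks (A A' : Matrix (Fin n) (Fin n) ℂ) (B B' : Matrix (Fin n) (Fin k) ℂ)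
    (C C' : Matrix (Fin k) (Fin n) ℂ) (D D' : Matrix (Fin k) (Fin k) ℂ) :
    blocks A B C D * blocks A' B' C' D' =
      blocks (A * A' + B * C') (A * B' + B * D') (C * A' + D * C') (C * B' + D * D') := by
  simp only [blocks, Matrix.reindex_apply, Matrix.submatrix_mul_equiv, Matrix.fromBlocks_multiply]

theorem blocks_conjTranspose (A : Matrix (Fin n) (Fin n) ℂ) (B : Matrix (Fin n) (Fin k) ℂ)
    (C : Matrix (Fin k) (Fin n) ℂ) (D : Matrix (Fin k) (Fin k) ℂ) :
    (blocks A B C D)ᴴ = blocks Aᴴ Cᴴ Bᴴ Dᴴ := by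
  simp only [blocks, Matrix.reindex_apply, Matrix.conjTranspose_submatrix,
    Matrix.fromBlocks_conjTranspose]

theorem blocks_one :
    blocks (1 : Matrix (Fin n) (Fin n) ℂ) 0 0 (1 : Matrix (Fin k) (Fin k) ℂ) = 1 := by
  simp [blocks]

theorem blocks_neg (A : Matrix (Fin n) (Fin n) ℂ) (B : Matrix (Fin n) (Fin k) ℂ)
    (C : Matrix (Fin k) (Fin n) ℂ) (D : Matrix (Fin k) (Fin k) ℂ) :
    -blocks A B C D = blocks (-A) (-B) (-C) (-D) := by
  simp only [blocks, Matrix.reindex_apply, ← Matrix.fromBlocks_neg, Matrix.submatrix_neg]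
  rfl

theorem matrix_ext_blocks {R : Type*} {X Y : Matrix (Fin (n + k)) (Fin (n + k)) R}
    (h₁ : ∀ i j, X (Fin.castAdd k i) (Fin.castAdd k j) = Y (Fin.castAdd k i) (Fin.castAdd k j))
    (h₂ : ∀ i j, X (Fin.castAdd k i) (Fin.natAdd n j) = Y (Fin.castAdd k i) (Fin.natAdd n j))
    (h₃ : ∀ i j, X (Fin.natAdd n i) (Fin.castAdd k j) = Y (Fin.natAdd n i) (Fin.castAdd k j))
    (h₄ : ∀ i j, X (Fin.natAdd n i) (Fin.natAdd n j) = Y (Fin.natAdd n i) (Fin.natAdd n j)) :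
    X = Y :=
  Matrix.ext fun i j => Fin.addCases
    (fun i => Fin.addCases (fun j => h₁ i j) (fun j => h₂ i j) j)
    (fun i => Fin.addCases (fun j => h₃ i j) (fun j => h₄ i j) j) i

theorem blocks_diag_mem_unitaryGroup {A : Matrix (Fin n) (Fin n) ℂ} {D : Matrix (Fin k) (Fin k) ℂ}
    (hA : A ∈ Matrix.unitaryGroup (Fin n) ℂ) (hD : D ∈ Matrix.unitaryGroup (Fin k) ℂ) :
    blocks A 0 0 D ∈ Matrix.unitaryGroup (Fin (n + k)) ℂ := by
  rw [Matrix.mem_unitaryGroup_iff, Matrix.star_eq_conjTranspose] at *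
  simp [blocks_conjTranspose, blocks_mul_blocks, hA, hD, blocks_one]

theorem HasDerivAt.blocks_diag {f : ℝ → Matrix (Fin n) (Fin n) ℂ} {g : ℝ → Matrix (Fin k) (Fin k) ℂ}
    {f' : Matrix (Fin n) (Fin n) ℂ} {g' : Matrix (Fin k) (Fin k) ℂ} {t : ℝ}
    (hf : HasDerivAt f f' t) (hg : HasDerivAt g g' t) :
    HasDerivAt (fun t => blocks (f t) 0 0 (g t)) (blocks f' 0 0 g') t := by
  rw [hasDerivAt_matrix_iff] at *
  intro i j
  refine Fin.addCases (fun i => ?_) (fun i => ?_) i <;>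
    refine Fin.addCases (fun j => ?_) (fun j => ?_) j <;>
    simp only [blocks_castAdd_castAdd, blocks_castAdd_natAdd, blocks_natAdd_castAdd,
      blocks_natAdd_natAdd]
  · exact hf i j
  · exact hasDerivAt_const t _
  · exact hasDerivAt_const t _
  · exact hg i j

theorem ContDiff.blocks_diag {f : ℝ → Matrix (Fin n) (Fin n) ℂ} {g : ℝ → Matrix (Fin k) (Fin k) ℂ}
    (hf : ContDiff ℝ ∞ f) (hg : ContDiff ℝ ∞ g) :
    ContDiff ℝ ∞ (fun t => blocks (f t) 0 0 (g t)) := by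
  rw [← contDiffOn_univ, contDiffOn_matrix_iff] at *
  intro i j
  refine Fin.addCases (fun i => ?_) (fun i => ?_) i <;>
    refine Fin.addCases (fun j => ?_) (fun j => ?_) j <;>
    simp only [blocks_castAdd_castAdd, blocks_castAdd_natAdd, blocks_natAdd_castAdd,
      blocks_natAdd_natAdd]
  · exact hf i j
  · exact contDiffOn_const
  · exact contDiffOn_const
  · exact hg i j

end BlockAlgebra

/-! ### The explicit solution by induction over the tree. -/

section ExplicitSolution

open scoped Matrix.Norms.Operator

theorem BracketTree.one_le {N : ℕ} (T : BracketTree N) : 1 ≤ N := by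
  induction T with
  | leaf n c => omega
  | node c T₁ T₂ h₁ h₂ => omega

/-- The generator `[[ξA, Ω], [-Ωᴴ, ξB]]` of the last factor of the explicit solution. -/
noncomputable def nodeGenerator {n k : ℕ} (c : ℝ) (T₁ : BracketTree n) (T₂ : BracketTree k)
    (W : Matrix (Fin (n + k)) (Fin (n + k)) ℂ) : Matrix (Fin (n + k)) (Fin (n + k)) ℂ :=
  blocks (c⁻¹ • angularMomentum T₁.metric (W.submatrix (Fin.castAdd k) (Fin.castAdd k)))
    (W.submatrix (Fin.castAdd k) (Fin.natAdd n)) (-(W.submatrix (Fin.castAdd k) (Fin.natAdd n))ᴴ)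
    (c⁻¹ • angularMomentum T₂.metric (W.submatrix (Fin.natAdd n) (Fin.natAdd n)))

theorem BracketTree.solution_leaf (n : ℕ) (c : ℝ) (W : Matrix (Fin (n + 1)) (Fin (n + 1)) ℂ) :
    (BracketTree.leaf n c).solution W = fun t => NormedSpace.exp (t • -W) := by
  funext t
  rw [BracketTree.solution, Complex.coe_smul, smul_neg]

theorem BracketTree.solution_node {n k : ℕ} (c : ℝ) (T₁ : BracketTree n) (T₂ : BracketTree k)
    (W : Matrix (Fin (n + k)) (Fin (n + k)) ℂ) :
    (BracketTree.node c T₁ T₂).solution W = fun t =>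
      blocks
        (T₁.solution (W.submatrix (Fin.castAdd k) (Fin.castAdd k)) t * NormedSpace.exp (t • c⁻¹ •
          angularMomentum T₁.metric (W.submatrix (Fin.castAdd k) (Fin.castAdd k)))) 0 0
        (T₂.solution (W.submatrix (Fin.natAdd n) (Fin.natAdd n)) t * NormedSpace.exp (t • c⁻¹ •
          angularMomentum T₂.metric (W.submatrix (Fin.natAdd n) (Fin.natAdd n)))) *
      NormedSpace.exp (t • -nodeGenerator c T₁ T₂ W) := by
  funext t
  rw [BracketTree.solution, blocks_mul_blocks]
  simp only [mul_smul, Complex.coe_smul, Matrix.mul_zero, Matrix.zero_mul, add_zero, zero_add,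
    smul_neg]
  rfl

theorem IsInitialVelocity.castAdd {n k : ℕ} {W : Matrix (Fin (n + k)) (Fin (n + k)) ℂ}
    (h : IsInitialVelocity W) : IsInitialVelocity (W.submatrix (Fin.castAdd k) (Fin.castAdd k)) :=
  ⟨by rw [Matrix.conjTranspose_submatrix, h.1]; rfl, fun i => h.2 _⟩

theorem IsInitialVelocity.natAdd {n k : ℕ} {W : Matrix (Fin (n + k)) (Fin (n + k)) ℂ}
    (h : IsInitialVelocity W) : IsInitialVelocity (W.submatrix (Fin.natAdd n) (Fin.natAdd n)) :=
  ⟨by rw [Matrix.conjTranspose_submatrix, h.1]; rfl, fun i => h.2 _⟩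

theorem nodeGenerator_conjTranspose {n k : ℕ} (c : ℝ) (T₁ : BracketTree n) (T₂ : BracketTree k)
    {W : Matrix (Fin (n + k)) (Fin (n + k)) ℂ} (h : IsInitialVelocity W) :
    (nodeGenerator c T₁ T₂ W)ᴴ = -nodeGenerator c T₁ T₂ W := by
  rw [nodeGenerator, blocks_conjTranspose, blocks_neg,
    conjTranspose_real_smul (angularMomentum_conjTranspose T₁.metric_comm h.castAdd.1),
    conjTranspose_real_smul (angularMomentum_conjTranspose T₂.metric_comm h.natAdd.1),
    Matrix.conjTranspose_neg, Matrix.conjTranspose_conjTranspose, neg_neg]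

theorem BracketTree.solution_zero {N : ℕ} (T : BracketTree N) (W : Matrix (Fin N) (Fin N) ℂ) :
    T.solution W 0 = 1 := by
  induction T with
  | leaf n c => simp [solution_leaf]
  | node c T₁ T₂ h₁ h₂ => simp [solution_node, h₁, h₂, blocks_one]

theorem BracketTree.contDiff_solution {N : ℕ} (T : BracketTree N)
    (W : Matrix (Fin N) (Fin N) ℂ) : ContDiff ℝ ∞ (T.solution W) := by
  have hexp : ∀ {m : ℕ} (X : Matrix (Fin m) (Fin m) ℂ),
      ContDiff ℝ ∞ fun t : ℝ => NormedSpace.exp (t • X) := fun X =>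
    contDiff_matrix_exp.comp (contDiff_id.smul contDiff_const)
  induction T with
  | leaf n c => rw [solution_leaf]; exact hexp _
  | node c T₁ T₂ h₁ h₂ =>
    rw [solution_node]
    exact (((h₁ _).mul (hexp _)).blocks_diag ((h₂ _).mul (hexp _))).mul (hexp _)

theorem BracketTree.solution_mem_unitaryGroup {N : ℕ} (T : BracketTree N)
    {W : Matrix (Fin N) (Fin N) ℂ} (hW : IsInitialVelocity W) (t : ℝ) :
    T.solution W t ∈ Matrix.unitaryGroup (Fin N) ℂ := by
  have hexp : ∀ {m : ℕ} {X : Matrix (Fin m) (Fin m) ℂ}, Xᴴ = -X →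
      NormedSpace.exp (t • X) ∈ Matrix.unitaryGroup (Fin m) ℂ := fun hX =>
    exp_mem_unitaryGroup (conjTranspose_real_smul hX t)
  induction T with
  | leaf n c =>
    rw [solution_leaf]
    exact hexp (by rw [Matrix.conjTranspose_neg, hW.1])
  | node c T₁ T₂ h₁ h₂ =>
    rw [solution_node]
    refine mul_mem (blocks_diag_mem_unitaryGroup (mul_mem (h₁ hW.castAdd) (hexp ?_))
      (mul_mem (h₂ hW.natAdd) (hexp ?_))) (hexp ?_)
    · exact conjTranspose_real_smul
        (angularMomentum_conjTranspose T₁.metric_comm hW.castAdd.1) _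
    · exact conjTranspose_real_smul
        (angularMomentum_conjTranspose T₂.metric_comm hW.natAdd.1) _
    · rw [Matrix.conjTranspose_neg, nodeGenerator_conjTranspose c T₁ T₂ hW]

/-- Pulling c out of the off-diagonal blocks leaves ξ = 1/c on the inner momenta. Applied to W, it
identifies the generator M with L(W)/c. -/
theorem angularMomentum_node {n k : ℕ} {c : ℝ} (hc : c ≠ 0) (T₁ : BracketTree n)
    (T₂ : BracketTree k) (X : Matrix (Fin n) (Fin n) ℂ) (Y : Matrix (Fin n) (Fin k) ℂ)
    (Z : Matrix (Fin k) (Fin n) ℂ) (X' : Matrix (Fin k) (Fin k) ℂ) :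
    angularMomentum (BracketTree.node c T₁ T₂).metric (blocks X Y Z X') =
      c • blocks (c⁻¹ • angularMomentum T₁.metric X) Y Z (c⁻¹ • angularMomentum T₂.metric X') := by
  have hne : ∀ (i : Fin n) (j : Fin k), Fin.castAdd k i ≠ Fin.natAdd n j := fun i j h => by
    have := congrArg Fin.val h
    simp at this
    omega
  have hc' : (c : ℂ) ≠ 0 := Complex.ofReal_ne_zero.2 hc
  apply matrix_ext_blocks <;> intro i j <;>
    simp [angularMomentum, BracketTree.metric, hne, (hne _ _).symm, hc']

/-- The intertwining L(Ω)G = G L(W) is conservation of momentum. It must be part of the induction,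
since the outer bracket uses it to differentiate the inner solutions times exp(ξAt) and exp(ξBt). -/
theorem BracketTree.exists_angularVelocity {N : ℕ} (T : BracketTree N)
    (hT : ∀ i j, i ≠ j → T.metric i j ≠ 0) {W : Matrix (Fin N) (Fin N) ℂ}
    (hW : IsInitialVelocity W) : ∃ Ω : ℝ → Matrix (Fin N) (Fin N) ℂ, ∀ t,
      IsInitialVelocity (Ω t) ∧ HasDerivAt (T.solution W) (-Ω t * T.solution W t) t ∧
        angularMomentum T.metric (Ω t) * T.solution W t =
          T.solution W t * angularMomentum T.metric W := by
  induction T with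
  | leaf n c =>
    -- With a single coefficient L = cω commutes with ω, so the angular velocity is constant.
    refine ⟨fun _ => W, fun t => ⟨hW, ?_, ?_⟩⟩
    · rw [solution_leaf]
      exact hasDerivAt_exp_smul_const' (-W) t
    · have h1 : angularMomentum (BracketTree.leaf n c).metric W = c • W := by
        ext i j
        by_cases hij : i = j
        · simp [angularMomentum, hij, hW.2]
        · simp [angularMomentum, hij, BracketTree.metric]
      rw [h1, solution_leaf]
      exact ((((Commute.refl W).neg_right.smul_right t).exp_right).smul_left c).eq
  | @node n k c T₁ T₂ ih₁ ih₂ =>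
    have hc : c ≠ 0 := by
      -- Brackets are non-empty, so some pair of nodes lies across the two halves and has
      -- coefficient c.
      have h := hT (Fin.castAdd k ⟨0, T₁.one_le⟩) (Fin.natAdd n ⟨0, T₂.one_le⟩) (fun h => by
        have := congrArg Fin.val h
        have := T₁.one_le
        simp at *
        omega)
      rwa [show (BracketTree.node c T₁ T₂).metric (Fin.castAdd k ⟨0, T₁.one_le⟩)
        (Fin.natAdd n ⟨0, T₂.one_le⟩) = c from blocks_castAdd_natAdd _ _ _ _ _ _] at h
    obtain ⟨Ω₁, h₁⟩ := ih₁ (fun i j hij => by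
      simpa [BracketTree.metric] using hT (Fin.castAdd k i) (Fin.castAdd k j)
        fun h => hij (Fin.castAdd_injective _ _ h)) hW.castAdd
    obtain ⟨Ω₂, h₂⟩ := ih₂ (fun i j hij => by
      simpa [BracketTree.metric] using hT (Fin.natAdd n i) (Fin.natAdd n j)
        fun h => hij (Fin.natAdd_injective _ _ h)) hW.natAdd
    set W₁ := W.submatrix (Fin.castAdd k) (Fin.castAdd k)
    set W₂ := W.submatrix (Fin.natAdd n) (Fin.natAdd n)
    set Y := W.submatrix (Fin.castAdd k) (Fin.natAdd n)
    set A := angularMomentum T₁.metric W₁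
    set B := angularMomentum T₂.metric W₂
    have hA : Aᴴ = -A := angularMomentum_conjTranspose T₁.metric_comm hW.castAdd.1
    have hB : Bᴴ = -B := angularMomentum_conjTranspose T₂.metric_comm hW.natAdd.1
    set M := nodeGenerator c T₁ T₂ W
    set p : ℝ → Matrix (Fin n) (Fin n) ℂ := fun t =>
      T₁.solution W₁ t * NormedSpace.exp (t • c⁻¹ • A)
    set q : ℝ → Matrix (Fin k) (Fin k) ℂ := fun t =>
      T₂.solution W₂ t * NormedSpace.exp (t • c⁻¹ • B)
    have hpA : ∀ t, p t * A = angularMomentum T₁.metric (Ω₁ t) * p t := fun t => by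
      simp only [p]
      rw [← mul_assoc, (h₁ t).2.2, mul_assoc, mul_assoc,
        (((Commute.refl A).smul_right c⁻¹).smul_right t).exp_right.eq]
    have hqB : ∀ t, q t * B = angularMomentum T₂.metric (Ω₂ t) * q t := fun t => by
      simp only [q]
      rw [← mul_assoc, (h₂ t).2.2, mul_assoc, mul_assoc,
        (((Commute.refl B).smul_right c⁻¹).smul_right t).exp_right.eq]
    -- The exponential contributes p(ξA), which the intertwining moves to the left as ξL₁(Ω₁)p.
    have hp : ∀ t, HasDerivAt p
        ((c⁻¹ • angularMomentum T₁.metric (Ω₁ t) - Ω₁ t) * p t) t := fun t => by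
      refine ((h₁ t).2.1.mul (hasDerivAt_exp_smul_const (c⁻¹ • A) t)).congr_deriv ?_
      rw [sub_mul, smul_mul_assoc, ← hpA]
      simp only [p, mul_assoc, neg_mul, mul_smul_comm]
      exact neg_add_eq_sub _ _
    have hq : ∀ t, HasDerivAt q
        ((c⁻¹ • angularMomentum T₂.metric (Ω₂ t) - Ω₂ t) * q t) t := fun t => by
      refine ((h₂ t).2.1.mul (hasDerivAt_exp_smul_const (c⁻¹ • B) t)).congr_deriv ?_
      rw [sub_mul, smul_mul_assoc, ← hqB]
      simp only [q, mul_assoc, neg_mul, mul_smul_comm]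
      exact neg_add_eq_sub _ _
    have hpu : ∀ t, (p t)ᴴ * p t = 1 := fun t => Matrix.mem_unitaryGroup_iff'.1
      (mul_mem (T₁.solution_mem_unitaryGroup hW.castAdd t)
        (exp_mem_unitaryGroup (conjTranspose_real_smul (conjTranspose_real_smul hA _) _)))
    have hqu : ∀ t, (q t)ᴴ * q t = 1 := fun t => Matrix.mem_unitaryGroup_iff'.1
      (mul_mem (T₂.solution_mem_unitaryGroup hW.natAdd t)
        (exp_mem_unitaryGroup (conjTranspose_real_smul (conjTranspose_real_smul hB _) _)))
    set h : ℝ → Matrix (Fin (n + k)) (Fin (n + k)) ℂ := fun t => blocks (p t) 0 0 (q t)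
    -- The inner angular velocities evolve as in the inner problems, while the off-diagonal block is
    -- the initial one carried along by p and q.
    set Ω : ℝ → Matrix (Fin (n + k)) (Fin (n + k)) ℂ := fun t =>
      blocks (Ω₁ t) (p t * Y * (q t)ᴴ) (-(p t * Y * (q t)ᴴ)ᴴ) (Ω₂ t)
    set P : ℝ → Matrix (Fin (n + k)) (Fin (n + k)) ℂ := fun t =>
      blocks (c⁻¹ • angularMomentum T₁.metric (Ω₁ t)) (p t * Y * (q t)ᴴ)
        (-(p t * Y * (q t)ᴴ)ᴴ) (c⁻¹ • angularMomentum T₂.metric (Ω₂ t))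
    have hPh : ∀ t, P t * h t = h t * M := fun t => by
      simp only [P, h, M, nodeGenerator]
      rw [blocks_mul_blocks, blocks_mul_blocks]
      congr 1
      · simp only [Matrix.mul_zero, Matrix.zero_mul, add_zero]
        rw [smul_mul_assoc, ← hpA, mul_smul_comm]
      · simp only [Matrix.mul_zero, Matrix.zero_mul, add_zero, zero_add, Matrix.mul_assoc, hqu,
          Matrix.mul_one]
        rfl
      · simp only [Matrix.mul_zero, Matrix.zero_mul, add_zero, zero_add, Matrix.neg_mul,
          Matrix.mul_neg, Matrix.conjTranspose_mul, Matrix.conjTranspose_conjTranspose,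
          Matrix.mul_assoc, hpu, Matrix.mul_one]
        rfl
      · simp only [Matrix.mul_zero, Matrix.zero_mul, zero_add]
        rw [smul_mul_assoc, ← hqB, mul_smul_comm]
    have hsol : (BracketTree.node c T₁ T₂).solution W =
        fun t => h t * NormedSpace.exp (t • -M) := solution_node c T₁ T₂ W
    have hPΩ : ∀ t, angularMomentum (BracketTree.node c T₁ T₂).metric (Ω t) = c • P t := fun t =>
      angularMomentum_node hc T₁ T₂ _ _ _ _
    have hMW : angularMomentum (BracketTree.node c T₁ T₂).metric W = c • M := by
      have hWb : W = blocks W₁ Y (-Yᴴ) W₂ := by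
        apply matrix_ext_blocks <;> intro i j <;> simp [W₁, W₂, Y]
        have := congrFun (congrFun hW.1 (Fin.natAdd n i)) (Fin.castAdd k j)
        simp only [Matrix.conjTranspose_apply, Matrix.neg_apply] at this
        simpa using (neg_eq_iff_eq_neg.2 this).symm
      conv_lhs => rw [hWb]
      exact angularMomentum_node hc T₁ T₂ _ _ _ _
    refine ⟨Ω, fun t => ⟨⟨?_, ?_⟩, ?_, ?_⟩⟩
    · simp only [Ω]
      rw [blocks_conjTranspose, blocks_neg, (h₁ t).1.1, (h₂ t).1.1, Matrix.conjTranspose_neg,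
        Matrix.conjTranspose_conjTranspose, neg_neg]
    · intro i
      refine Fin.addCases (fun i => ?_) (fun i => ?_) i
      · simpa [Ω] using (h₁ t).1.2 i
      · simpa [Ω] using (h₂ t).1.2 i
    · rw [hsol]
      refine (((hp t).blocks_diag (hq t)).mul (hasDerivAt_exp_smul_const' (-M) t)).congr_deriv ?_
      have h3 : blocks ((c⁻¹ • angularMomentum T₁.metric (Ω₁ t) - Ω₁ t) * p t) 0 0
          ((c⁻¹ • angularMomentum T₂.metric (Ω₂ t) - Ω₂ t) * q t) = (P t - Ω t) * h t := by
        -- P and Ω have the same off-diagonal blocks, so their difference is block-diagonal and can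
        -- generate h.
        have h4 : P t - Ω t = blocks (c⁻¹ • angularMomentum T₁.metric (Ω₁ t) - Ω₁ t) 0 0
            (c⁻¹ • angularMomentum T₂.metric (Ω₂ t) - Ω₂ t) := by
          apply matrix_ext_blocks <;> intro i j <;> simp [P, Ω]
        rw [h4]
        simp [h, blocks_mul_blocks]
      rw [h3]
      change _ + h t * _ = _
      rw [sub_mul, hPh]
      simp only [neg_mul, mul_neg, sub_mul, mul_assoc]
      abel
    · rw [hPΩ, hMW, hsol]
      simp only [smul_mul_assoc, mul_smul_comm]
      rw [← mul_assoc, hPh, mul_assoc, mul_assoc,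
        (((Commute.refl M).neg_right).smul_right t).exp_right.eq]

end ExplicitSolution

/-! ### Uniqueness, horizontal lifts and the general solution. -/

section GeneralSolution

open Set
open scoped Matrix.Norms.Operator

theorem angularMomentum_congr {N : ℕ} {c c' : Fin N → Fin N → ℝ}
    (h : ∀ i j, i ≠ j → c i j = c' i j) : angularMomentum c = angularMomentum c' := by
  funext x
  ext i j
  by_cases hij : i = j
  · simp [angularMomentum, hij]
  · simp [angularMomentum, hij, h i j hij]

theorem angularMomentum_inv {N : ℕ} {c : Fin N → Fin N → ℝ} (h : ∀ i j, i ≠ j → c i j ≠ 0)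
    {x : Matrix (Fin N) (Fin N) ℂ} (hx : ∀ i, x i i = 0) :
    angularMomentum (fun i j => (c i j)⁻¹) (angularMomentum c x) = x := by
  ext i j
  by_cases hij : i = j
  · simp [angularMomentum, hij, hx]
  · simp [angularMomentum, hij, h i j hij]

theorem NestedDiagram.metric_ne_zero {N : ℕ} (D : NestedDiagram N) (i j : Fin N) (h : i ≠ j) :
    D.metric i j ≠ 0 := (D.pos i j h).ne'

theorem IsGeodesicOn.congr {N : ℕ} {c : Fin N → Fin N → ℝ} {γ γ' : ℝ → CompleteFlag N}
    {J : Set ℝ} (hg : IsGeodesicOn c γ J) (h : ∀ t ∈ J, γ' t = γ t) : IsGeodesicOn c γ' J := by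
  obtain ⟨⟨u, hu, hflag⟩, hstat⟩ := hg
  refine ⟨⟨u, hu, fun t ht => (hflag t ht).trans (h t ht).symm⟩,
    fun a b hab hI v hv h0 ha hb => hstat a b hab hI v hv (fun t ht => (h0 t ht).trans (h t ht))
      (fun s => (ha s).trans (h a (hI (left_mem_Icc.2 hab.le))))
      fun s => (hb s).trans (h b (hI (right_mem_Icc.2 hab.le)))⟩

/-- The curve of frames `G(t) u₀` given by the explicit solution operator. -/
noncomputable def BracketTree.solutionFrame {N : ℕ} (T : BracketTree N)
    {W : Matrix (Fin N) (Fin N) ℂ} (hW : IsInitialVelocity W) (u₀ : Matrix.unitaryGroup (Fin N) ℂ)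
    (t : ℝ) : Matrix.unitaryGroup (Fin N) ℂ :=
  ⟨T.solution W t, T.solution_mem_unitaryGroup hW t⟩ * u₀

theorem BracketTree.solutionFrame_zero {N : ℕ} (T : BracketTree N)
    {W : Matrix (Fin N) (Fin N) ℂ} (hW : IsInitialVelocity W)
    (u₀ : Matrix.unitaryGroup (Fin N) ℂ) : T.solutionFrame hW u₀ 0 = u₀ := by
  apply Subtype.ext
  change T.solution W 0 * u₀.1 = u₀.1
  rw [T.solution_zero, one_mul]

theorem BracketTree.smoothFrameOn_solutionFrame {N : ℕ} (T : BracketTree N)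
    {W : Matrix (Fin N) (Fin N) ℂ} (hW : IsInitialVelocity W)
    (u₀ : Matrix.unitaryGroup (Fin N) ℂ) (J : Set ℝ) : SmoothFrameOn (T.solutionFrame hW u₀) J :=
  smoothFrameOn_iff.2 ((T.contDiff_solution W).mul contDiff_const).contDiffOn

theorem BracketTree.solutionFrame_spec {N : ℕ} (T : BracketTree N)
    (hT : ∀ i j, i ≠ j → T.metric i j ≠ 0) {W : Matrix (Fin N) (Fin N) ℂ}
    (hW : IsInitialVelocity W) (u₀ : Matrix.unitaryGroup (Fin N) ℂ) :
    angularVelocity (T.solutionFrame hW u₀) 0 = W ∧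
      HorizontalOn (T.solutionFrame hW u₀) univ ∧
      EulerOn T.metric (T.solutionFrame hW u₀) univ := by
  obtain ⟨Ω, hΩ⟩ := T.exists_angularVelocity hT hW
  set G := T.solution W with hGdef
  have hGu : ∀ t, G t * (G t)ᴴ = 1 := fun t =>
    Matrix.mem_unitaryGroup_iff.1 (T.solution_mem_unitaryGroup hW t)
  have hd : ∀ t, HasDerivAt (fun τ => (T.solutionFrame hW u₀ τ).1)
      (-Ω t * G t * u₀.1) t := fun t => (hΩ t).2.1.mul_const u₀.1
  have hω : ∀ t, angularVelocity (T.solutionFrame hW u₀) t = Ω t := fun t => by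
    rw [angularVelocity_eq (hd t)]
    change G t * u₀.1 * _ = _
    rw [Matrix.conjTranspose_mul, Matrix.conjTranspose_mul, mul_assoc, ← mul_assoc u₀.1,
      frame_mul_conjTranspose, one_mul, ← mul_assoc, hGu, one_mul, Matrix.conjTranspose_neg,
      (hΩ t).1.1, neg_neg]
  have hL : ∀ t, angularMomentum T.metric (Ω t) =
      G t * angularMomentum T.metric W * (G t)ᴴ := fun t => by
    rw [← (hΩ t).2.2, mul_assoc, hGu, mul_one]
  refine ⟨?_, fun t _ => (horizontal_iff (hd t)).2 fun i => by rw [hω]; exact (hΩ t).1.2 i, ?_⟩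
  -- Ω is only known to exist; its value at 0 is recovered from its momentum, because both Ω(0) and
  -- W have zero diagonal.
  · have h0 := hL 0
    rw [hGdef, T.solution_zero, Matrix.conjTranspose_one, one_mul, mul_one] at h0
    rw [hω, ← angularMomentum_inv hT (hΩ 0).1.2, h0, angularMomentum_inv hT hW.2]
  · rw [eulerOn_iff]
    intro t _
    have h1 := ((hΩ t).2.1.mul_const (angularMomentum T.metric W)).mul
      (hΩ t).2.1.matrix_conjTranspose
    rw [show (fun τ => angularMomentum T.metric (angularVelocity (T.solutionFrame hW u₀) τ)) =
      fun τ => G τ * angularMomentum T.metric W * (G τ)ᴴ from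
        funext fun τ => by rw [hω, hL]]
    refine h1.congr_deriv ?_
    change -Ω t * G t * angularMomentum T.metric W * (G t)ᴴ +
      G t * angularMomentum T.metric W * (-Ω t * G t)ᴴ = _
    rw [hω, Ring.lie_def, hL, Matrix.conjTranspose_mul, Matrix.conjTranspose_neg, (hΩ t).1.1]
    simp only [neg_neg, neg_mul, mul_assoc]
    exact neg_add_eq_sub _ _

theorem HorizontalOn.isInitialVelocity {N : ℕ} {J : Set ℝ} (hJ : IsOpen J)
    {u : ℝ → Matrix.unitaryGroup (Fin N) ℂ} (hu : SmoothFrameOn u J) (hh : HorizontalOn u J)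
    {t : ℝ} (ht : t ∈ J) : IsInitialVelocity (angularVelocity u t) :=
  ⟨angularVelocity_conjTranspose (hu.hasDerivAt hJ ht),
    (horizontal_iff (hu.hasDerivAt hJ ht)).1 (hh t ht)⟩

/-- The angular momentum in the fixed frame is conserved. -/
theorem EulerOn.angularMomentum_conserved {N : ℕ} {c : Fin N → Fin N → ℝ} {J : Set ℝ}
    (hJ : IsOpen J) (hJc : J.OrdConnected) (h0 : (0 : ℝ) ∈ J)
    {u : ℝ → Matrix.unitaryGroup (Fin N) ℂ} (hu : SmoothFrameOn u J) (he : EulerOn c u J)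
    {t : ℝ} (ht : t ∈ J) :
    (u t).1ᴴ * angularMomentum c (angularVelocity u t) * (u t).1 =
      (u 0).1ᴴ * angularMomentum c (angularVelocity u 0) * (u 0).1 := by
  rw [eulerOn_iff] at he
  have hd : ∀ t ∈ J, HasDerivAt
      (fun τ => (u τ).1ᴴ * angularMomentum c (angularVelocity u τ) * (u τ).1) 0 t := by
    intro t ht
    have h1 := hu.hasDerivAt hJ ht
    rw [velocity_eq_neg_angularVelocity_mul h1] at h1
    -- The derivative is u†(ωL + [L, ω] - Lω)u = 0.
    refine ((h1.matrix_conjTranspose.mul (he t ht)).mul h1).congr_deriv ?_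
    change ((-angularVelocity u t * (u t).1)ᴴ * angularMomentum c (angularVelocity u t) +
      (u t).1ᴴ * ⁅angularMomentum c (angularVelocity u t), angularVelocity u t⁆) * (u t).1 +
      (u t).1ᴴ * angularMomentum c (angularVelocity u t) * (-angularVelocity u t * (u t).1) = 0
    rw [Matrix.conjTranspose_mul, Matrix.conjTranspose_neg, angularVelocity_conjTranspose h1,
      Ring.lie_def]
    simp only [neg_neg, neg_mul, mul_neg, mul_sub, add_mul, sub_mul, mul_assoc]
    rw [add_sub_cancel]
    exact add_neg_cancel _
  refine hJ.is_const_of_deriv_eq_zero hJc.isPreconnected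
    (fun t ht => (hd t ht).differentiableAt.differentiableWithinAt) (fun t ht => (hd t ht).deriv)
    ht h0

/-- Conservation of K = u†Lu reduces the second-order problem to u̇ = -Λ⁻¹(uKu†)u, where Λ⁻¹ divides
off-diagonal entries by c_ij. Equal initial data give the same K, hence the same equation for both
curves. -/
theorem eqOn_of_eulerOn {N : ℕ} {c : Fin N → Fin N → ℝ} (hne : ∀ i j, i ≠ j → c i j ≠ 0)
    {J : Set ℝ} (hJ : IsOpen J) (hJc : J.OrdConnected) (h0 : (0 : ℝ) ∈ J)
    {u w : ℝ → Matrix.unitaryGroup (Fin N) ℂ} (hu : SmoothFrameOn u J) (hw : SmoothFrameOn w J)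
    (hhu : HorizontalOn u J) (hhw : HorizontalOn w J) (heu : EulerOn c u J) (hew : EulerOn c w J)
    (huw : u 0 = w 0) (hω : angularVelocity u 0 = angularVelocity w 0) : EqOn u w J := by
  set K := (u 0).1ᴴ * angularMomentum c (angularVelocity u 0) * (u 0).1 with hK
  set F : Matrix (Fin N) (Fin N) ℂ → Matrix (Fin N) (Fin N) ℂ := fun x =>
    -momentumMap (fun i j => (c i j)⁻¹) (x * K * xᴴ) * x
  have hF : ContDiff ℝ 1 F := by
    have hstar : ContDiff ℝ 1 fun x : Matrix (Fin N) (Fin N) ℂ => xᴴ :=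
      contDiffOn_univ.1 contDiffOn_id.matrix_conjTranspose
    exact (((momentumMap _).contDiff.comp
      ((contDiff_id.mul contDiff_const).mul hstar)).neg).mul contDiff_id
  have hode : ∀ {v : ℝ → Matrix.unitaryGroup (Fin N) ℂ}, SmoothFrameOn v J → HorizontalOn v J →
      EulerOn c v J → (v 0).1ᴴ * angularMomentum c (angularVelocity v 0) * (v 0).1 = K →
      ∀ t ∈ J, HasDerivAt (fun τ => (v τ).1) (F (v t).1) t := by
    intro v hv hh he hvK t ht
    have h1 := hv.hasDerivAt hJ ht
    rw [velocity_eq_neg_angularVelocity_mul h1] at h1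
    refine h1.congr_deriv ?_
    have h2 : (v t).1 * K * (v t).1ᴴ = angularMomentum c (angularVelocity v t) := by
      rw [← hvK, ← he.angularMomentum_conserved hJ hJc h0 hv ht]
      simp only [mul_assoc]
      rw [frame_mul_conjTranspose, mul_one, ← mul_assoc, frame_mul_conjTranspose, one_mul]
    simp only [F]
    rw [h2, momentumMap_apply, angularMomentum_inv hne (hh.isInitialVelocity hJ hv ht).2]
  have hou := hode hu hhu heu rfl
  have how := hode hw hhw hew (by rw [hK, huw, hω])
  intro t ht
  -- A compact interval in J with both 0 and t in its interior is needed: compactness makes F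
  -- Lipschitz on the two images.
  have hmin : min 0 t ∈ J := by rcases min_choice 0 t with h | h <;> rwa [h]
  have hmax : max 0 t ∈ J := by rcases max_choice 0 t with h | h <;> rwa [h]
  obtain ⟨l, r, hlr, hsub⟩ := mem_nhds_iff_exists_Ioo_subset.1 (hJ.mem_nhds hmin)
  obtain ⟨l', r', hlr', hsub'⟩ := mem_nhds_iff_exists_Ioo_subset.1 (hJ.mem_nhds hmax)
  obtain ⟨a, hla, ha⟩ := exists_between hlr.1
  obtain ⟨b, hb, hbr⟩ := exists_between hlr'.2
  have hI : Icc a b ⊆ J := hJc.out (hsub ⟨hla, ha.trans hlr.2⟩) (hsub' ⟨hlr'.1.trans hb, hbr⟩)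
  have hI' : Ioo a b ⊆ J := Ioo_subset_Icc_self.trans hI
  have hcpt : IsCompact ((fun τ => (u τ).1) '' Icc a b ∪ (fun τ => (w τ).1) '' Icc a b) :=
    (isCompact_Icc.image_of_continuousOn ((smoothFrameOn_iff.1 hu).continuousOn.mono hI)).union
      (isCompact_Icc.image_of_continuousOn ((smoothFrameOn_iff.1 hw).continuousOn.mono hI))
  obtain ⟨C, hC⟩ := hF.locallyLipschitz.locallyLipschitzOn.exists_lipschitzOnWith_of_compact hcpt
  have hEq := ODE_solution_unique_of_mem_Ioo (v := fun _ => F)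
    (s := fun _ => (fun τ => (u τ).1) '' Icc a b ∪ (fun τ => (w τ).1) '' Icc a b)
    (fun _ _ => hC) (t₀ := 0) ⟨ha.trans_le (min_le_left _ _), (le_max_left _ _).trans_lt hb⟩
    (fun τ hτ => ⟨hou τ (hI' hτ), Or.inl ⟨τ, Ioo_subset_Icc_self hτ, rfl⟩⟩)
    (fun τ hτ => ⟨how τ (hI' hτ), Or.inr ⟨τ, Ioo_subset_Icc_self hτ, rfl⟩⟩)
    (congrArg Subtype.val huw)
  exact Subtype.ext
    (hEq ⟨ha.trans_le (min_le_right _ _), (le_max_right _ _).trans_lt hb⟩)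

theorem contDiffOn_integral_of_contDiffOn {f : ℝ → ℝ} {J : Set ℝ} (hJ : IsOpen J)
    (hJc : J.OrdConnected) (h0 : (0 : ℝ) ∈ J) (hf : ContDiffOn ℝ ∞ f J) :
    (∀ t ∈ J, HasDerivAt (fun t => ∫ τ in (0 : ℝ)..t, f τ) (f t) t) ∧
      ContDiffOn ℝ ∞ (fun t => ∫ τ in (0 : ℝ)..t, f τ) J := by
  have hd : ∀ t ∈ J, HasDerivAt (fun t => ∫ τ in (0 : ℝ)..t, f τ) (f t) t := fun t ht =>
    intervalIntegral.integral_hasDerivAt_right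
      ((hf.continuousOn.mono (hJc.uIcc_subset h0 ht)).intervalIntegrable)
      (hf.continuousOn.stronglyMeasurableAtFilter hJ t ht)
      (hf.continuousOn.continuousAt (hJ.mem_nhds ht))
  refine ⟨hd, (contDiffOn_infty_iff_deriv_of_isOpen hJ).2
    ⟨fun t ht => (hd t ht).differentiableAt.differentiableWithinAt,
      hf.congr fun t ht => (hd t ht).deriv⟩⟩

theorem diagonal_mem_unitaryGroup {N : ℕ} {d : Fin N → ℂ} (hd : ∀ i, ‖d i‖ = 1) :
    Matrix.diagonal d ∈ Matrix.unitaryGroup (Fin N) ℂ := by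
  rw [Matrix.mem_unitaryGroup_iff, Matrix.star_eq_conjTranspose, Matrix.diagonal_conjTranspose,
    Matrix.diagonal_mul_diagonal, ← Matrix.diagonal_one]
  congr 1
  funext i
  simp [Complex.mul_conj, Complex.normSq_eq_norm_sq, hd i]

/-- Every smooth curve of flags has a horizontal lift through any frame of its initial flag. -/
theorem exists_horizontal_lift {N : ℕ} {J : Set ℝ} (hJ : IsOpen J) (hJc : J.OrdConnected)
    (h0 : (0 : ℝ) ∈ J) {u : ℝ → Matrix.unitaryGroup (Fin N) ℂ} (hu : SmoothFrameOn u J)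
    {u₀ : Matrix.unitaryGroup (Fin N) ℂ} (hu₀ : toFlag u₀ = toFlag (u 0)) :
    ∃ w : ℝ → Matrix.unitaryGroup (Fin N) ℂ, SmoothFrameOn w J ∧ HorizontalOn w J ∧ w 0 = u₀ ∧
      ∀ t, toFlag (w t) = toFlag (u t) := by
  obtain ⟨d, hd1, hd⟩ := toFlag_eq_iff.1 hu₀
  -- ω_ii is imaginary, so the phase solving ė_i = ω_ii e_i is the exponential of its integral. Its
  -- gauge term contributes -ω_ii to the new diagonal and cancels it. The constants d_i adjust the
  -- initial frame.
  set φ : Fin N → ℝ → ℝ := fun i t => ∫ τ in (0 : ℝ)..t, (angularVelocity u τ i i).im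
  have hφ : ∀ i, (∀ t ∈ J, HasDerivAt (φ i) (angularVelocity u t i i).im t) ∧
      ContDiffOn ℝ ∞ (φ i) J := fun i =>
    contDiffOn_integral_of_contDiffOn hJ hJc h0 (Complex.imCLM.contDiff.comp_contDiffOn
      (contDiffOn_matrix_iff.1 (hu.contDiffOn_angularVelocity hJ) i i))
  set e : ℝ → Fin N → ℂ := fun t i => d i * Complex.exp (φ i t * Complex.I)
  have he1 : ∀ t i, ‖e t i‖ = 1 := fun t i => by
    simp [e, hd1 i, Complex.norm_exp_ofReal_mul_I]
  have hre : ∀ t ∈ J, ∀ i, (angularVelocity u t i i).im * Complex.I =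
      angularVelocity u t i i := fun t ht i => by
    have h1 : star (angularVelocity u t i i) = -angularVelocity u t i i :=
      congrFun (congrFun (angularVelocity_conjTranspose (hu.hasDerivAt hJ ht)) i) i
    have h2 := congrArg Complex.re h1
    simp only [Complex.star_def, Complex.conj_re, Complex.neg_re] at h2
    apply Complex.ext <;> simp
    linarith
  have hed : ∀ t ∈ J, ∀ i, HasDerivAt (fun t => e t i) (angularVelocity u t i i * e t i) t :=
    fun t ht i => by
      have h1 := ((((hφ i).1 t ht).ofReal_comp.mul_const Complex.I).cexp).const_mul (d i)
      refine h1.congr_deriv ?_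
      rw [hre t ht i]
      simp only [e]
      ring
  have hes : ∀ i, ContDiffOn ℝ ∞ (fun t => e t i) J := fun i =>
    contDiffOn_const.mul
      (((Complex.ofRealCLM.contDiff.comp_contDiffOn (hφ i).2).mul contDiffOn_const).cexp)
  set w : ℝ → Matrix.unitaryGroup (Fin N) ℂ := fun t =>
    ⟨Matrix.diagonal (e t), diagonal_mem_unitaryGroup (he1 t)⟩ * u t
  have hwe : ∀ t, (w t).1 = Matrix.diagonal (e t) * (u t).1 := fun t => rfl
  refine ⟨w, fun i k => ?_, fun t ht => ?_, Subtype.ext ?_, fun t =>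
    toFlag_eq_iff.2 ⟨e t, he1 t, hwe t⟩⟩
  · simp only [hwe, Matrix.diagonal_mul]
    exact (hes i).mul (hu i k)
  · have hDd : HasDerivAt (fun τ => Matrix.diagonal (e τ))
        (Matrix.diagonal fun i => angularVelocity u t i i * e t i) t := by
      rw [hasDerivAt_matrix_iff]
      intro i j
      by_cases hij : i = j
      · subst hij
        simpa using hed t ht i
      · simpa [Matrix.diagonal_apply_ne _ hij] using hasDerivAt_const t (0 : ℂ)
    have hwd := hDd.mul (hu.hasDerivAt hJ ht)
    have hωw : angularVelocity w t =
        Matrix.diagonal (e t) * (Matrix.diagonal fun i => angularVelocity u t i i * e t i)ᴴ +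
        Matrix.diagonal (e t) * angularVelocity u t * (Matrix.diagonal (e t))ᴴ := by
      rw [angularVelocity_eq (u := w) hwd, angularVelocity_eq (hu.hasDerivAt hJ ht), hwe t]
      simp only [Matrix.conjTranspose_add, Matrix.conjTranspose_mul, mul_add]
      rw [mul_assoc (Matrix.diagonal (e t)), ← mul_assoc (u t).1, frame_mul_conjTranspose, one_mul]
      simp only [mul_assoc]
    refine (horizontal_iff (u := w) hwd).2 fun i => ?_
    have h1 : star (angularVelocity u t i i) = -angularVelocity u t i i :=
      congrFun (congrFun (angularVelocity_conjTranspose (hu.hasDerivAt hJ ht)) i) i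
    rw [hωw, Matrix.diagonal_conjTranspose, Matrix.diagonal_conjTranspose,
      Matrix.diagonal_mul_diagonal, Matrix.add_apply, Matrix.mul_diagonal, Matrix.diagonal_mul,
      Matrix.diagonal_apply_eq]
    simp only [Pi.star_apply, star_mul', h1]
    ring
  · rw [hwe, hd]
    simp [e, φ]

/-- The product of one frame with the adjoint of the other stays diagonal near 0, and its derivative
at 0 is W' - W. Both matrices have zero diagonal, so they agree. -/
theorem BracketTree.eq_of_toFlag_solutionFrame_eq {N : ℕ} (T : BracketTree N)
    (hT : ∀ i j, i ≠ j → T.metric i j ≠ 0) {W W' : Matrix (Fin N) (Fin N) ℂ}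
    (hW : IsInitialVelocity W) (hW' : IsInitialVelocity W') (u₀ : Matrix.unitaryGroup (Fin N) ℂ)
    (h : ∀ᶠ t in nhds 0, toFlag (T.solutionFrame hW u₀ t) = toFlag (T.solutionFrame hW' u₀ t)) :
    W = W' := by
  have hd := (T.smoothFrameOn_solutionFrame hW u₀ univ).hasDerivAt isOpen_univ (mem_univ 0)
  have hd' := (T.smoothFrameOn_solutionFrame hW' u₀ univ).hasDerivAt isOpen_univ (mem_univ 0)
  have e1 := velocity_eq_neg_angularVelocity_mul hd
  have e2 := velocity_eq_neg_angularVelocity_mul hd'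
  rw [(T.solutionFrame_spec hT hW u₀).1, T.solutionFrame_zero] at e1
  rw [(T.solutionFrame_spec hT hW' u₀).1, T.solutionFrame_zero] at e2
  rw [e1] at hd
  rw [e2] at hd'
  have hD := isDiag_of_hasDerivAt (hd.mul hd'.matrix_conjTranspose)
    (h.mono fun t ht => isDiag_of_toFlag_eq ht)
  rw [T.solutionFrame_zero, T.solutionFrame_zero, mul_assoc, frame_mul_conjTranspose, mul_one,
    Matrix.conjTranspose_mul, ← mul_assoc, frame_mul_conjTranspose, one_mul,
    Matrix.conjTranspose_neg, hW'.1, neg_neg, neg_add_eq_sub] at hD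
  ext i j
  by_cases hij : i = j
  · rw [hij, hW.2, hW'.2]
  · exact (sub_eq_zero.1 (hD hij)).symm

end GeneralSolution

theorem proposition6 (N : ℕ) (hN : 1 ≤ N) (D : NestedDiagram N) :
    -- the geodesic equations are the generalized Euler equations
    (∀ (J : Set ℝ), IsOpen J → ∀ u : ℝ → Matrix.unitaryGroup (Fin N) ℂ, SmoothFrameOn u J →
      (IsGeodesicOn D.metric (fun t => toFlag (u t)) J ↔ EulerOn D.metric u J)) ∧
    -- the metric is given by a bracket tree
    (∃ T : BracketTree N, T.Represents D) ∧
    ∀ T : BracketTree N, T.Represents D →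
      -- for all initial data, `u(t) = G(t) u₀` is a (horizontally lifted) geodesic
      (∀ (u₀ : Matrix.unitaryGroup (Fin N) ℂ) (W : Matrix (Fin N) (Fin N) ℂ),
        IsInitialVelocity W →
        ∃ u : ℝ → Matrix.unitaryGroup (Fin N) ℂ,
          (∀ t, (u t).1 = T.solution W t * u₀.1) ∧ u 0 = u₀ ∧ angularVelocity u 0 = W ∧
          SmoothFrameOn u Set.univ ∧ HorizontalOn u Set.univ ∧
          IsGeodesicOn D.metric (fun t => toFlag (u t)) Set.univ) ∧
      -- every horizontally lifted geodesic, on any interval, is of this form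
      (∀ J : Set ℝ, IsOpen J → J.OrdConnected → (0 : ℝ) ∈ J →
        ∀ u : ℝ → Matrix.unitaryGroup (Fin N) ℂ, SmoothFrameOn u J → HorizontalOn u J →
          IsGeodesicOn D.metric (fun t => toFlag (u t)) J →
          IsInitialVelocity (angularVelocity u 0) ∧
          ∀ t ∈ J, (u t).1 = T.solution (angularVelocity u 0) t * (u 0).1) ∧
      -- every geodesic of flags, on any interval, is of this form, with unique initial velocity
      (∀ J : Set ℝ, IsOpen J → J.OrdConnected → (0 : ℝ) ∈ J →
        ∀ γ : ℝ → CompleteFlag N, IsGeodesicOn D.metric γ J →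
          ∀ u₀ : Matrix.unitaryGroup (Fin N) ℂ, toFlag u₀ = γ 0 →
            ∃! W : Matrix (Fin N) (Fin N) ℂ, IsInitialVelocity W ∧
              ∀ t ∈ J, ∃ u : Matrix.unitaryGroup (Fin N) ℂ,
                u.1 = T.solution W t * u₀.1 ∧ toFlag u = γ t) := by
  have hcomm := D.metric_comm
  have geod : ∀ (J : Set ℝ), IsOpen J → ∀ u : ℝ → Matrix.unitaryGroup (Fin N) ℂ,
      SmoothFrameOn u J →
      (IsGeodesicOn D.metric (fun t => toFlag (u t)) J ↔ EulerOn D.metric u J) :=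
    fun J hJ u hu => ⟨EulerOn.of_isGeodesicOn hcomm hJ hu, IsGeodesicOn.of_eulerOn hcomm hJ hu⟩
  refine ⟨geod, D.exists_tree hN, fun T hTD => ?_⟩
  have hT : ∀ i j, i ≠ j → T.metric i j ≠ 0 := fun i j hij => by
    rw [hTD i j hij]
    exact D.metric_ne_zero i j hij
  -- The tree and the diagram may differ on the diagonal, which the momentum ignores.
  have hΛ : angularMomentum T.metric = angularMomentum D.metric := angularMomentum_congr hTD
  have hEuler : ∀ {W : Matrix (Fin N) (Fin N) ℂ} (hW : IsInitialVelocity W)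
      (u₀ : Matrix.unitaryGroup (Fin N) ℂ) (J : Set ℝ),
      EulerOn D.metric (T.solutionFrame hW u₀) J := fun hW u₀ J t _ => by
    rw [← hΛ]
    exact (T.solutionFrame_spec hT hW u₀).2.2 t (Set.mem_univ t)
  have unique : ∀ J : Set ℝ, IsOpen J → J.OrdConnected → (0 : ℝ) ∈ J →
      ∀ u : ℝ → Matrix.unitaryGroup (Fin N) ℂ, SmoothFrameOn u J → HorizontalOn u J →
        IsGeodesicOn D.metric (fun t => toFlag (u t)) J →
        IsInitialVelocity (angularVelocity u 0) ∧
        ∀ t ∈ J, (u t).1 = T.solution (angularVelocity u 0) t * (u 0).1 := by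
    intro J hJ hJc h0 u hu hh hg
    have hW := hh.isInitialVelocity hJ hu h0
    refine ⟨hW, fun t ht => congrArg Subtype.val (?_ : u t = T.solutionFrame hW (u 0) t)⟩
    exact eqOn_of_eulerOn D.metric_ne_zero hJ hJc h0 hu (T.smoothFrameOn_solutionFrame hW _ J) hh
      (fun t _ => (T.solutionFrame_spec hT hW (u 0)).2.1 t (Set.mem_univ t))
      ((geod J hJ u hu).1 hg) (hEuler hW _ J) (T.solutionFrame_zero hW _).symm
      (T.solutionFrame_spec hT hW (u 0)).1.symm ht
  refine ⟨fun u₀ W hW => ?_, unique, fun J hJ hJc h0 γ hγ u₀ hu₀ => ?_⟩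
  · have hs := T.smoothFrameOn_solutionFrame hW u₀ Set.univ
    exact ⟨T.solutionFrame hW u₀, fun _ => rfl, T.solutionFrame_zero hW u₀,
      (T.solutionFrame_spec hT hW u₀).1, hs, (T.solutionFrame_spec hT hW u₀).2.1,
      (geod _ isOpen_univ _ hs).2 (hEuler hW u₀ _)⟩
  · obtain ⟨⟨u, hu, hflag⟩, -⟩ := id hγ
    obtain ⟨w, hw, hhw, hw0, hwu⟩ :=
      exists_horizontal_lift hJ hJc h0 hu (hu₀.trans (hflag 0 h0).symm)
    have hwγ : ∀ t ∈ J, toFlag (w t) = γ t := fun t ht => (hwu t).trans (hflag t ht)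
    obtain ⟨hW, hwt⟩ := unique J hJ hJc h0 w hw hhw (hγ.congr hwγ)
    rw [hw0] at hwt
    refine ⟨angularVelocity w 0, ⟨hW, fun t ht => ⟨w t, hwt t ht, hwγ t ht⟩⟩, ?_⟩
    rintro W' ⟨hW', hsol⟩
    -- Uniqueness of W uses only the flags at times near 0.
    refine T.eq_of_toFlag_solutionFrame_eq hT hW' hW u₀ ?_
    filter_upwards [hJ.mem_nhds h0] with t ht
    obtain ⟨v, hv, hvγ⟩ := hsol t ht
    rw [show T.solutionFrame hW' u₀ t = v from Subtype.ext hv.symm, hvγ,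
      show T.solutionFrame hW u₀ t = w t from Subtype.ext (hwt t ht).symm, hwγ t ht]
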